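/- Let $0\le p<q$ with $p+q=1$, let $y\in\mathbb R$, and let $R>0$ satisfy $qR^2>R+p$ (equivalently, $R$ is so large that $p+q\xi\xi'-\xi\ne0$ whenever $|\xi|,|\xi'|\ge R$). For real $x$ and $t$ let $K=K_{x,t}$ be the operator on $L^2(\mathcal C_R)$, where $\mathcal C_R$ is the circle $|\xi|=R$ with arc length, given by $$Kf(\xi)=\frac1{2\pi i}\int_{\mathcal C_R}K(\xi,\xi')\,f(\xi')\,d\xi',\qquad K(\xi,\xi')=\frac{\xi^{x}\,e^{\varepsilon(\xi)t}}{p+q\,\xi\xi'-\xi},\qquad \varepsilon(\xi)=p\,\xi^{-1}+q\,\xi-1,$$ the contour being described counterclockwise and $\xi^x$ being the principal power (the ordinary power when $x$ is an integer). Let $K_0$ be the operator on $L^2(\mathbb R)$ with kernel $$K_0(z,z')=\frac1{\sqrt{2\pi}}\,e^{-(p^2+q^2)(z^2+z'^2)/4+pq\,zz'},$$ and let $\chi_{(-y,\infty)}$ denote multiplication by the indicator function of $(-y,\infty)$. Then for every integer $n\ge1$ the operators $K_{x,t}^n$ (for all real $x,t$) and $(K_0\,\chi_{(-y,\infty)})^n$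 are trace class, and with $$x=x(t)=(p-q)\,t+(q-p)\,y\,t^{1/2}$$ one has $$\operatorname{tr}K_{x(t),t}^{\,n}\longrightarrow\operatorname{tr}\,(K_0\,\chi_{(-y,\infty)})^n\qquad\text{as }t\to\infty .$$ -/

import Mathlib

open MeasureTheory Filter Topology Real

/-! ### Trace class operators and the trace -/

/-- `T` is trace class (nuclear) on the Hilbert space `H`: it is a sum of rank one operators
`f ↦ ⟨a n, f⟩ b n` with `∑ ‖a n‖ ‖b n‖ < ∞`. -/
def IsTraceClass {H : Type*} [NormedAddCommGroup H] [InnerProductSpace ℂ H]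
    (T : H →L[ℂ] H) : Prop :=
  ∃ a b : ℕ → H, Summable (fun n => ‖a n‖ * ‖b n‖) ∧
    ∀ f : H, HasSum (fun n => inner ℂ (a n) f • b n) (T f)

/-- The index set of some Hilbert basis of `H`. -/
noncomputable def someBasisIndex (H : Type*) [NormedAddCommGroup H] [InnerProductSpace ℂ H]
    [CompleteSpace H] : Set H :=
  (exists_hilbertBasis ℂ H).choose

/-- Some Hilbert basis of `H`. -/
noncomputable def someBasis (H : Type*) [NormedAddCommGroup H] [InnerProductSpace ℂ H]
    [CompleteSpace H] : HilbertBasis (someBasisIndex H) ℂ H :=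
  (exists_hilbertBasis ℂ H).choose_spec.choose

/-- The trace `∑ ⟨e i, T (e i)⟩` over a Hilbert basis `e`; for trace class `T` the sum converges
absolutely and does not depend on the basis. -/
noncomputable def opTrace {H : Type*} [NormedAddCommGroup H] [InnerProductSpace ℂ H]
    [CompleteSpace H] (T : H →L[ℂ] H) : ℂ :=
  ∑' i, inner ℂ (someBasis H i) (T (someBasis H i))

/-! ### Integral operators with square integrable kernel -/

section IntegralOperator

variable {α : Type*} [MeasurableSpace α] {μ : Measure α} [SFinite μ] {k : α → α → ℂ}

theorem kernel_slice_memLp (hk : MemLp (Function.uncurry k) 2 (μ.prod μ)) :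
    ∀ᵐ x ∂μ, MemLp (k x) 2 μ := by
  have h1 := (memLp_two_iff_integrable_sq_norm hk.1).1 hk
  filter_upwards [h1.prod_right_ae, hk.1.prodMk_left] with x hx hm
  exact (memLp_two_iff_integrable_sq_norm hm).2 hx

theorem kernel_slice_integrable (hk : MemLp (Function.uncurry k) 2 (μ.prod μ)) {f : α → ℂ}
    (hf : MemLp f 2 μ) : ∀ᵐ x ∂μ, Integrable (fun y => k x y * f y) μ := by
  filter_upwards [kernel_slice_memLp hk] with x hx
  exact hx.integrable_mul hf

theorem kernel_eLpNorm_le (hk : MemLp (Function.uncurry k) 2 (μ.prod μ)) {f : α → ℂ}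
    (hf : MemLp f 2 μ) :
    eLpNorm (fun x => ∫ y, k x y * f y ∂μ) 2 μ ≤
      eLpNorm (Function.uncurry k) 2 (μ.prod μ) * eLpNorm f 2 μ := by
  have two : ∀ {β : Type _} [MeasurableSpace β] (ν : Measure β) (g : β → ℂ),
      eLpNorm g 2 ν = (∫⁻ x, ‖g x‖ₑ ^ (2 : ℝ) ∂ν) ^ (1 / 2 : ℝ) := by
    intro β _ ν g
    rw [eLpNorm_eq_lintegral_rpow_enorm_toReal (by simp) (by simp)]
    simp
  have hpt : ∀ᵐ x ∂μ, ‖∫ y, k x y * f y ∂μ‖ₑ ^ (2 : ℝ) ≤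
      (∫⁻ y, ‖k x y‖ₑ ^ (2 : ℝ) ∂μ) * (∫⁻ y, ‖f y‖ₑ ^ (2 : ℝ) ∂μ) := by
    filter_upwards [kernel_slice_memLp hk] with x hx
    have h1 : ‖∫ y, k x y * f y ∂μ‖ₑ ≤ ∫⁻ y, ‖k x y‖ₑ * ‖f y‖ₑ ∂μ := by
      refine (enorm_integral_le_lintegral_enorm _).trans (le_of_eq ?_)
      simp
    have h2 := ENNReal.lintegral_mul_le_Lp_mul_Lq μ Real.HolderConjugate.two_two
      hx.1.enorm hf.1.enorm
    have h3 := ENNReal.rpow_le_rpow (h1.trans h2) (by norm_num : (0 : ℝ) ≤ 2)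
    rw [ENNReal.mul_rpow_of_nonneg _ _ (by norm_num), ← ENNReal.rpow_mul, ← ENNReal.rpow_mul]
      at h3
    simpa using h3
  rw [two, two, two, ← ENNReal.mul_rpow_of_nonneg _ _ (by norm_num)]
  refine ENNReal.rpow_le_rpow ?_ (by norm_num)
  refine (lintegral_mono_ae hpt).trans (le_of_eq ?_)
  have hfin : (∫⁻ y, ‖f y‖ₑ ^ (2 : ℝ) ∂μ) ≠ ⊤ := by
    have := hf.2
    rw [two] at this
    intro h
    rw [h, ENNReal.top_rpow_of_pos (by norm_num)] at this
    exact lt_irrefl _ this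
  rw [lintegral_mul_const' _ _ hfin, lintegral_prod _ (hk.1.enorm.pow_const 2)]
  rfl

theorem kernel_memLp (hk : MemLp (Function.uncurry k) 2 (μ.prod μ)) {f : α → ℂ}
    (hf : MemLp f 2 μ) : MemLp (fun x => ∫ y, k x y * f y ∂μ) 2 μ := by
  refine ⟨?_, (kernel_eLpNorm_le hk hf).trans_lt (ENNReal.mul_lt_top hk.2 hf.2)⟩
  exact (hk.1.mul hf.1.comp_snd).integral_prod_right'

/-- The bounded operator `(T f)(x) = ∫ k(x, y) f(y) dμ(y)` on `L²(μ)` with kernel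
`k ∈ L²(μ × μ)`. -/
noncomputable def hilbertSchmidtOperator (hk : MemLp (Function.uncurry k) 2 (μ.prod μ)) :
    Lp ℂ 2 μ →L[ℂ] Lp ℂ 2 μ :=
  LinearMap.mkContinuous
    { toFun := fun f => (kernel_memLp hk (Lp.memLp f)).toLp _
      map_add' := by
        intro f g
        rw [← MemLp.toLp_add]
        refine MemLp.toLp_congr _ _ ?_
        filter_upwards [kernel_slice_integrable hk (Lp.memLp f),
          kernel_slice_integrable hk (Lp.memLp g)] with x h1 h2
        rw [Pi.add_apply, ← integral_add h1 h2]
        refine integral_congr_ae ?_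
        filter_upwards [Lp.coeFn_add f g] with y hy
        rw [hy, Pi.add_apply, mul_add]
      map_smul' := by
        intro c f
        rw [RingHom.id_apply, ← MemLp.toLp_const_smul]
        refine MemLp.toLp_congr _ _ (Eventually.of_forall fun x => ?_)
        rw [Pi.smul_apply, smul_eq_mul, ← integral_const_mul]
        refine integral_congr_ae ?_
        filter_upwards [Lp.coeFn_smul c f] with y hy
        rw [hy, Pi.smul_apply, smul_eq_mul]
        ring }
    (eLpNorm (Function.uncurry k) 2 (μ.prod μ)).toReal
    (by
      intro f
      simp only [LinearMap.coe_mk, AddHom.coe_mk]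
      rw [Lp.norm_toLp, Lp.norm_def, ← ENNReal.toReal_mul]
      exact ENNReal.toReal_mono (ENNReal.mul_lt_top hk.2 (Lp.memLp f).2).ne
        (kernel_eLpNorm_le hk (Lp.memLp f)))

end IntegralOperator

open Classical in
/-- The integral operator with kernel `k` on `L²(μ)`, for a square integrable kernel
(and `0` for other kernels, which do not occur below). -/
noncomputable def integralOperator {α : Type*} [MeasurableSpace α] (μ : Measure α) [SFinite μ]
    (k : α → α → ℂ) : Lp ℂ 2 μ →L[ℂ] Lp ℂ 2 μ :=
  if hk : MemLp (Function.uncurry k) 2 (μ.prod μ) then hilbertSchmidtOperator hk else 0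

theorem integralOperator_ae {α : Type*} [MeasurableSpace α] {μ : Measure α} [SFinite μ]
    {k : α → α → ℂ} (hk : MemLp (Function.uncurry k) 2 (μ.prod μ)) (f : Lp ℂ 2 μ) :
    integralOperator μ k f =ᵐ[μ] fun x => ∫ y, k x y * f y ∂μ := by
  rw [integralOperator, dif_pos hk]
  exact MemLp.coeFn_toLp (kernel_memLp hk (Lp.memLp f))

/-! ### The ASEP operator on a circle -/

/-- Arc length on the circle `|ξ| = R`, as a measure on `ℂ`. -/
noncomputable def arcLength (R : ℝ) : Measure ℂ :=
  ENNReal.ofReal R • (volume.restrict (Set.Ioc 0 (2 * π))).map (circleMap 0 R)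

instance arcLength_isFiniteMeasure (R : ℝ) : IsFiniteMeasure (arcLength R) := by
  unfold arcLength
  exact Measure.smul_finite _ ENNReal.ofReal_ne_top

/-- `ε(ξ) = p / ξ + q ξ - 1`. -/
noncomputable def asepEps (p q : ℝ) (ξ : ℂ) : ℂ := p * ξ⁻¹ + q * ξ - 1

/-- The kernel `K(ξ, ξ') = ξ ^ x e ^ (ε(ξ) t) / (p + q ξ ξ' - ξ)`, where `ξ ^ x` is the principal
power (the usual power when `x` is an integer). -/
noncomputable def asepKernel (p q x t : ℝ) (ξ ξ' : ℂ) : ℂ :=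
  ξ ^ (x : ℂ) * Complex.exp (asepEps p q ξ * t) / (p + q * ξ * ξ' - ξ)

/-- On the circle `|ξ| = R`, described counterclockwise, `dξ / (2πi)` is `ξ / (2πR)` times
arc length. -/
theorem integral_arcLength {R : ℝ} (hR : 0 < R) (g : ℂ → ℂ)
    (hg : AEStronglyMeasurable g (arcLength R)) :
    ∫ ξ, g ξ * (ξ / (2 * π * R)) ∂(arcLength R) =
      (2 * π * Complex.I)⁻¹ * ∮ ξ in C(0, R), g ξ := by
  have hR' : (R : ℂ) ≠ 0 := by exact_mod_cast hR.ne'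
  have hpi : (π : ℂ) ≠ 0 := by exact_mod_cast Real.pi_ne_zero
  have h0 : ENNReal.ofReal R ≠ 0 := by simpa using hR
  have hg' : AEStronglyMeasurable g
      ((volume.restrict (Set.Ioc 0 (2 * π))).map (circleMap 0 R)) := by
    refine hg.mono_ac ?_
    unfold arcLength
    exact Measure.absolutelyContinuous_smul h0
  unfold arcLength
  have hm : AEStronglyMeasurable (fun ξ : ℂ => g ξ * (ξ / (2 * π * R)))
      ((volume.restrict (Set.Ioc 0 (2 * π))).map (circleMap 0 R)) :=
    hg'.mul (by fun_prop)
  rw [integral_smul_measure,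
    integral_map (continuous_circleMap 0 R).measurable.aemeasurable hm, circleIntegral,
    intervalIntegral.integral_of_le (by positivity), ENNReal.toReal_ofReal hR.le,
    ← integral_smul, ← integral_const_mul]
  refine integral_congr_ae (Eventually.of_forall fun θ => ?_)
  simp only [deriv_circleMap, smul_eq_mul, Complex.real_smul]
  field_simp

/-- The operator `(K f)(ξ) = (1 / 2πi) ∫ K(ξ, ξ') f(ξ') dξ'` on `L²` of the circle `|ξ| = R`;
the contour integral is over that circle, counterclockwise. -/
noncomputable def asepOperator (p q x t R : ℝ) :
    Lp ℂ 2 (arcLength R) →L[ℂ] Lp ℂ 2 (arcLength R) :=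
  integralOperator (arcLength R) fun ξ ξ' => asepKernel p q x t ξ ξ' * (ξ' / (2 * π * R))

/-! ### The symmetrized Mehler kernel -/

/-- `K₀(z, z') = (2π)^(-1/2) exp(-(p² + q²)(z² + z'²)/4 + p q z z')`. -/
noncomputable def mehlerKernel (p q z z' : ℝ) : ℝ :=
  (√(2 * π))⁻¹ * Real.exp (-(p ^ 2 + q ^ 2) * (z ^ 2 + z' ^ 2) / 4 + p * q * z * z')

/-- The operator `K₀ χ` on `L²(ℝ)`, where `χ` is multiplication by the indicator function of
`(-y, ∞)`; its kernel is `K₀(z, z') χ(z')`. -/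
noncomputable def mehlerCutOperator (p q y : ℝ) :
    Lp ℂ 2 (volume : Measure ℝ) →L[ℂ] Lp ℂ 2 (volume : Measure ℝ) :=
  integralOperator volume fun z z' =>
    (Set.Ioi (-y)).indicator (fun w => (mehlerKernel p q z w : ℂ)) z'

/-! ### The two kernels are square integrable -/

theorem ae_norm_arcLength {R : ℝ} (hR : 0 < R) : ∀ᵐ ξ ∂(arcLength R), ‖ξ‖ = R := by
  unfold arcLength
  refine Measure.ae_smul_measure ?_ _
  rw [ae_map_iff (continuous_circleMap 0 R).measurable.aemeasurable
    (measurableSet_eq_fun measurable_norm measurable_const)]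
  exact Eventually.of_forall fun θ => by simp [abs_of_pos hR]

theorem asepKernel_memLp {p q : ℝ} (hp : 0 ≤ p) (hq : 0 < q) {R : ℝ} (hR : 0 < R)
    (hpR : R + p < q * R ^ 2) (x t : ℝ) :
    MemLp (Function.uncurry fun ξ ξ' => asepKernel p q x t ξ ξ' * (ξ' / (2 * π * R))) 2
      ((arcLength R).prod (arcLength R)) := by
  have hm : Measurable
      (Function.uncurry fun ξ ξ' => asepKernel p q x t ξ ξ' * (ξ' / (2 * π * R))) := by
    unfold asepKernel asepEps Function.uncurry
    fun_prop
  have hpi := Real.pi_pos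
  refine MemLp.of_bound hm.aestronglyMeasurable
    (R ^ x * Real.exp ((p / R + q * R + 1) * |t|) / (q * R ^ 2 - R - p) * (1 / (2 * π))) ?_
  have h1 := Measure.quasiMeasurePreserving_fst (μ := arcLength R) (ν := arcLength R)
    |>.ae (ae_norm_arcLength hR)
  have h2 := Measure.quasiMeasurePreserving_snd (μ := arcLength R) (ν := arcLength R)
    |>.ae (ae_norm_arcLength hR)
  filter_upwards [h1, h2] with ⟨ξ, ξ'⟩ h1 h2
  simp only at h1 h2
  simp only [Function.uncurry_apply_pair, asepKernel, norm_mul, norm_div]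
  have hξ : ξ ≠ 0 := by
    intro h
    rw [h, norm_zero] at h1
    exact hR.ne h1
  have e1 : ‖ξ ^ (x : ℂ)‖ = R ^ x := by
    rw [Complex.norm_cpow_of_ne_zero hξ, h1]
    simp
  have e2 : ‖Complex.exp (asepEps p q ξ * t)‖ ≤ Real.exp ((p / R + q * R + 1) * |t|) := by
    refine (Complex.norm_exp_le_exp_norm _).trans (Real.exp_le_exp.2 ?_)
    rw [norm_mul, Complex.norm_real, Real.norm_eq_abs]
    refine mul_le_mul_of_nonneg_right ?_ (abs_nonneg _)
    unfold asepEps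
    refine (norm_sub_le _ _).trans (add_le_add ((norm_add_le _ _).trans (le_of_eq ?_)) (by simp))
    simp [h1, abs_of_nonneg hp, abs_of_pos hq, div_eq_mul_inv]
  have e3 : q * R ^ 2 - R - p ≤ ‖(p : ℂ) + q * ξ * ξ' - ξ‖ := by
    have a1 : ‖(q : ℂ) * ξ * ξ'‖ = q * R ^ 2 := by
      simp [h1, h2, abs_of_pos hq]
      ring
    have a2 : ‖ξ - (p : ℂ)‖ ≤ R + p := by
      refine (norm_sub_le _ _).trans (le_of_eq ?_)
      simp [h1, abs_of_nonneg hp]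
    have a3 := norm_sub_norm_le ((q : ℂ) * ξ * ξ') (ξ - p)
    have a4 : (q : ℂ) * ξ * ξ' - (ξ - p) = p + q * ξ * ξ' - ξ := by ring
    rw [a4, a1] at a3
    linarith
  have e4 : ‖ξ'‖ / (‖(2 : ℂ)‖ * ‖(π : ℂ)‖ * ‖(R : ℂ)‖) = 1 / (2 * π) := by
    rw [h2]
    simp [abs_of_pos hR, abs_of_pos hpi]
    field_simp
  have e5 : 0 < q * R ^ 2 - R - p := by linarith
  rw [e1, e4]
  gcongr

theorem mehlerCut_memLp {p q : ℝ} (hp : 0 ≤ p) (hpq : p < q) (y : ℝ) :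
    MemLp (Function.uncurry fun z z' : ℝ =>
      (Set.Ioi (-y)).indicator (fun w => (mehlerKernel p q z w : ℂ)) z') 2
      (volume.prod volume) := by
  have hm0 : Measurable fun v : ℝ × ℝ => (mehlerKernel p q v.1 v.2 : ℂ) := by
    unfold mehlerKernel
    fun_prop
  have heq : (Function.uncurry fun z z' : ℝ =>
      (Set.Ioi (-y)).indicator (fun w => (mehlerKernel p q z w : ℂ)) z') =
      (Prod.snd ⁻¹' Set.Ioi (-y)).indicator
        fun v : ℝ × ℝ => (mehlerKernel p q v.1 v.2 : ℂ) := by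
    funext ⟨z, w⟩
    simp [Set.indicator]
  rw [heq]
  refine MemLp.indicator (measurable_snd measurableSet_Ioi) ?_
  rw [memLp_two_iff_integrable_sq_norm hm0.aestronglyMeasurable]
  have hc : 0 < (q - p) ^ 2 / 2 := by
    have : 0 < q - p := by linarith
    positivity
  have hG := ((integrable_exp_neg_mul_sq hc).mul_prod (integrable_exp_neg_mul_sq hc)).const_mul
    (2 * π)⁻¹
  refine hG.mono' (hm0.norm.pow_const 2).aestronglyMeasurable (Eventually.of_forall fun v => ?_)
  have hpi := Real.pi_pos
  rw [Complex.norm_real, Real.norm_eq_abs, Real.norm_eq_abs, sq_abs, abs_of_nonneg (sq_nonneg _),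
    mehlerKernel, mul_pow, inv_pow, Real.sq_sqrt (by positivity), ← Real.exp_add,
    ← Real.exp_nat_mul]
  refine mul_le_mul_of_nonneg_left (Real.exp_le_exp.2 ?_) (by positivity)
  push_cast
  have h1 : 0 ≤ p * q * (v.1 - v.2) ^ 2 :=
    mul_nonneg (mul_nonneg hp (by linarith)) (sq_nonneg _)
  linarith

/-! The denominator factors as `q ξ ξ' (1 - M(ξ)/ξ')` with the Möbius map `M(ξ) = (ξ - p)/(q ξ)`,
and the hypothesis on `R` says exactly that `|M| < R` on the circle. The geometric series therefore
writes `K` as an absolutely convergent sum of rank one operators. Hence its powers are trace class,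
and `tr K^n` is the trace of the `n`-th power of the infinite matrix `A j k = (2πq)⁻¹ ∫ ξ^(x-j-1)
e^(ε(ξ)t) M(ξ)^k dθ`, `ξ = R e^(iθ)` (`IsNuclearRep.opTrace_pow_eq`, `asepKernel_hasSum`). The
singularity that forced the circle to be large is gone: in the coordinate `log ξ` the integrand is
entire, so the contour may pass through the critical point `ξ = 1`, which is fixed by `M`.

Near that point put `θ = v/√t`, `j ≈ √t s`, `k ≈ √t s'`. The drift `(p-q)t` in `x(t)` cancels the
linear term of `ε t`, and `M^k` tends to `e^(i(p/q)s'v)`. A Gaussian Fourier integral then shows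
that `q√t A j k` converges to a Gaussian in `s - (p/q)s' - (q-p)y` (`tendsto_asepEntry`). With `s =
q(z+y)` this kernel is conjugate to `K₀`, and the range `j ≥ 0` becomes the half line cut out by
`χ`.

Convergence of traces also needs a bound uniform in all `j, k`. It comes from conjugating `A` by the
diagonal weights `ω_j = min_{1≤r≤R} e^(tH(r-1)) r^(-j)`, which leaves traces unchanged: the
conjugated entries are at most `(C/√t) e^(-k/√t)` (`exists_norm_asepEntry_le`). The function `H` is
quadratic at `0` and is chosen so that `Re ε + H(|M|-1) - (q-p) log|ξ|` is at most `H(|ξ|-1)`, with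
a quadratic gain in `|ξ|-1` and a linear gain in `|ξ| - Re ξ`. This rests on the identity `ε = q(ξ -
M)`. The left half plane contributes only an exponentially small amount.

The bound is stable under matrix multiplication, so writing sums as integrals of step functions and
using dominated convergence gives convergence of all powers and of their traces
(`tendsto_tsum_matrixIter`). For `K₀χ`, expanding `e^(pqzz')` in its power series gives a nuclear
representation and identifies the trace of a power with the integral of the iterated kernel on the
diagonal. -/

/-! ### Nuclear representations -/

section Nuclear

variable {H : Type*} [NormedAddCommGroup H] [InnerProductSpace ℂ H]

/-- `T` is the absolutely convergent sum of the rank one operators `f ↦ ⟨a n, f⟩ b n`. -/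
structure IsNuclearRep (a b : ℕ → H) (T : H →L[ℂ] H) : Prop where
  summable : Summable fun n => ‖a n‖ * ‖b n‖
  hasSum : ∀ f : H, HasSum (fun n => inner ℂ (a n) f • b n) (T f)

theorem IsNuclearRep.isTraceClass {a b : ℕ → H} {T : H →L[ℂ] H} (h : IsNuclearRep a b T) :
    IsTraceClass T :=
  ⟨a, b, h.summable, h.hasSum⟩

theorem IsNuclearRep.comp_left {a b : ℕ → H} {T : H →L[ℂ] H} (h : IsNuclearRep a b T)
    (S : H →L[ℂ] H) : IsNuclearRep a (fun n => S (b n)) (S * T) where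
  summable := by
    refine Summable.of_nonneg_of_le (fun n => by positivity) (fun n => ?_)
      (h.summable.mul_left ‖S‖)
    calc ‖a n‖ * ‖S (b n)‖ ≤ ‖a n‖ * (‖S‖ * ‖b n‖) := by gcongr; exact S.le_opNorm _
      _ = ‖S‖ * (‖a n‖ * ‖b n‖) := by ring
  hasSum f := by
    have := (h.hasSum f).mapL S
    simpa using this

theorem IsNuclearRep.pow_succ {a b : ℕ → H} {T : H →L[ℂ] H} (h : IsNuclearRep a b T) (m : ℕ) :
    IsNuclearRep a (fun n => (T ^ m) (b n)) (T ^ (m + 1)) := by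
  rw [_root_.pow_succ]
  exact h.comp_left _

theorem IsNuclearRep.hasSum_inner {a b : ℕ → H} {T : H →L[ℂ] H} (h : IsNuclearRep a b T)
    (u v : H) : HasSum (fun l => inner ℂ u (b l) * inner ℂ (a l) v) (inner ℂ u (T v)) := by
  have := (h.hasSum v).mapL (innerSL ℂ u)
  simpa [inner_smul_right, mul_comm] using this

theorem HilbertBasis.sum_norm_inner_mul_inner_le {ι : Type*} (e : HilbertBasis ι ℂ H) (x y : H)
    (s : Finset ι) : ∑ i ∈ s, ‖inner ℂ x (e i) * inner ℂ (e i) y‖ ≤ ‖x‖ * ‖y‖ := by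
  calc ∑ i ∈ s, ‖inner ℂ x (e i) * inner ℂ (e i) y‖
      = ∑ i ∈ s, ‖inner ℂ (e i) x‖ * ‖inner ℂ (e i) y‖ := by
        refine Finset.sum_congr rfl fun i _ => ?_
        rw [norm_mul, norm_inner_symm]
    _ ≤ √(∑ i ∈ s, ‖inner ℂ (e i) x‖ ^ 2) * √(∑ i ∈ s, ‖inner ℂ (e i) y‖ ^ 2) :=
        Real.sum_mul_le_sqrt_mul_sqrt _ _ _
    _ ≤ √(‖x‖ ^ 2) * √(‖y‖ ^ 2) := by
        gcongr <;> exact e.orthonormal.sum_inner_products_le _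
    _ = ‖x‖ * ‖y‖ := by
        rw [Real.sqrt_sq (norm_nonneg _), Real.sqrt_sq (norm_nonneg _)]

/-- Parseval in the basis for each `n`, after interchanging the two sums. The double series
converges absolutely by Cauchy–Schwarz and Bessel, since its inner sums are at most `‖a n‖ ‖b n‖`.
-/
theorem IsNuclearRep.opTrace_eq [CompleteSpace H] {a b : ℕ → H} {T : H →L[ℂ] H}
    (h : IsNuclearRep a b T) : opTrace T = ∑' n, inner ℂ (a n) (b n) := by
  set e := someBasis H
  have hsum : Summable fun x : ℕ × someBasisIndex H =>
      ‖inner ℂ (a x.1) (e x.2) * inner ℂ (e x.2) (b x.1)‖ := by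
    rw [summable_prod_of_nonneg fun _ => norm_nonneg _]
    refine ⟨fun n => ?_, ?_⟩
    · exact summable_of_sum_le (fun _ => norm_nonneg _)
        (e.sum_norm_inner_mul_inner_le (a n) (b n))
    · refine Summable.of_nonneg_of_le (fun n => tsum_nonneg fun _ => norm_nonneg _)
        (fun n => ?_) h.summable
      exact Real.tsum_le_of_sum_le (fun _ => norm_nonneg _)
        (e.sum_norm_inner_mul_inner_le (a n) (b n))
  have h1 : ∀ n, ∑' i, inner ℂ (a n) (e i) * inner ℂ (e i) (b n) = inner ℂ (a n) (b n) :=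
    fun n => e.tsum_inner_mul_inner _ _
  have h2 : ∀ i, ∑' n, inner ℂ (a n) (e i) * inner ℂ (e i) (b n) = inner ℂ (e i) (T (e i)) := by
    intro i
    rw [← (h.hasSum_inner (e i) (e i)).tsum_eq]
    exact tsum_congr fun n => mul_comm _ _
  unfold opTrace
  rw [← tsum_congr h1, ← tsum_congr h2]
  exact (Summable.of_norm hsum).tsum_comm

/-- The powers of the infinite matrix `A`: `matrixIter A m` is the `(m + 1)`-st power. -/
noncomputable def matrixIter (A : ℕ → ℕ → ℂ) : ℕ → ℕ → ℕ → ℂ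
  | 0 => A
  | m + 1 => fun j k => ∑' l, A j l * matrixIter A m l k

/-- Inserting `T = ∑ ⟨a l, ·⟩ b l` once for each factor turns composition of operators into
multiplication of the matrices `⟨a j, b k⟩`. -/
theorem IsNuclearRep.inner_pow_eq {a b : ℕ → H} {T : H →L[ℂ] H} (h : IsNuclearRep a b T)
    (m j k : ℕ) : inner ℂ (a j) ((T ^ m) (b k)) =
      matrixIter (fun j k => inner ℂ (a j) (b k)) m j k := by
  induction m generalizing j with
  | zero => simp [matrixIter]
  | succ m ih =>
    rw [_root_.pow_succ', mul_apply_eq_comp, ← (h.hasSum_inner _ _).tsum_eq]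
    simp only [matrixIter, ih]

theorem IsNuclearRep.opTrace_pow_eq [CompleteSpace H] {a b : ℕ → H} {T : H →L[ℂ] H}
    (h : IsNuclearRep a b T) (m : ℕ) : opTrace (T ^ (m + 1)) =
      ∑' k, matrixIter (fun j k => inner ℂ (a j) (b k)) m k k := by
  rw [(h.pow_succ m).opTrace_eq]
  exact tsum_congr fun k => h.inner_pow_eq m k k

end Nuclear

/-! ### Integral operators with a separated kernel expansion -/

section KernelExpansion

variable {α : Type*} [MeasurableSpace α] {μ : Measure α} [SFinite μ]

theorem MemLp.norm_toLp_le_of_le {α : Type*} [MeasurableSpace α] {μ : Measure α}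
    {a : α → ℂ} {g : α → ℝ} {c : ℝ} (hc : 0 ≤ c) (ha : MemLp a 2 μ)
    (hg : MemLp g 2 μ) (h : ∀ᵐ x ∂μ, ‖a x‖ ≤ c * g x) :
    ‖ha.toLp a‖ ≤ c * ‖hg.toLp g‖ := by
  refine Lp.norm_le_mul_norm_of_ae_le_mul ?_
  filter_upwards [h, ha.coeFn_toLp, hg.coeFn_toLp] with x h1 h2 h3
  rw [h2, h3]
  exact h1.trans (mul_le_mul_of_nonneg_left (le_abs_self _) hc)

theorem inner_toLp_eq {α : Type*} [MeasurableSpace α] {μ : Measure α}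
    {a : α → ℂ} (ha : MemLp a 2 μ) (f : Lp ℂ 2 μ) :
    inner ℂ (ha.toLp a) f = ∫ x, starRingEnd ℂ (a x) * f x ∂μ := by
  rw [L2.inner_def]
  refine integral_congr_ae ?_
  filter_upwards [ha.coeFn_toLp] with x hx
  rw [hx, RCLike.inner_apply, mul_comm]

/-- A kernel with an expansion `k(x, y) = ∑ b n x * conj (a n y)` dominated by `g` defines a
nuclear operator. -/
theorem isNuclearRep_integralOperator {k : α → α → ℂ}
    (hk : MemLp (Function.uncurry k) 2 (μ.prod μ)) {a b : ℕ → α → ℂ} {g : α → ℝ} {c d : ℕ → ℝ}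
    (hc : ∀ n, 0 ≤ c n) (hd : ∀ n, 0 ≤ d n) (hcd : Summable fun n => c n * d n)
    (ha : ∀ n, MemLp (a n) 2 μ) (hb : ∀ n, MemLp (b n) 2 μ) (hg : MemLp g 2 μ)
    (hag : ∀ n, ∀ᵐ x ∂μ, ‖a n x‖ ≤ c n * g x) (hbg : ∀ n, ∀ᵐ x ∂μ, ‖b n x‖ ≤ d n * g x)
    (hsum : ∀ᵐ x ∂μ, ∀ᵐ y ∂μ, HasSum (fun n => b n x * starRingEnd ℂ (a n y)) (k x y)) :
    IsNuclearRep (fun n => (ha n).toLp (a n)) (fun n => (hb n).toLp (b n))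
      (integralOperator μ k) := by
  have hS : Summable fun n => ‖(ha n).toLp (a n)‖ * ‖(hb n).toLp (b n)‖ := by
    refine Summable.of_nonneg_of_le (fun n => by positivity) (fun n => ?_)
      (hcd.mul_right (‖hg.toLp g‖ * ‖hg.toLp g‖))
    calc _ ≤ (c n * ‖hg.toLp g‖) * (d n * ‖hg.toLp g‖) := by
          gcongr
          · exact mul_nonneg (hc n) (norm_nonneg _)
          · exact MemLp.norm_toLp_le_of_le (hc n) _ hg (hag n)
          · exact MemLp.norm_toLp_le_of_le (hd n) _ hg (hbg n)
      _ = _ := by ring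
  refine ⟨hS, fun f => ?_⟩
  -- The rank one series converges in `L²`; what remains is to identify its sum with the integral
  -- operator.
  have hsf : Summable fun n => inner ℂ ((ha n).toLp (a n)) f • (hb n).toLp (b n) := by
    refine Summable.of_norm_bounded (hS.mul_right ‖f‖) fun n => ?_
    rw [norm_smul]
    calc _ ≤ (‖(ha n).toLp (a n)‖ * ‖f‖) * ‖(hb n).toLp (b n)‖ := by
          gcongr; exact norm_inner_le_norm _ _
      _ = _ := by ring
  obtain ⟨S, hSf⟩ := hsf
  suffices h : S = integralOperator μ k f from h ▸ hSf
  -- Convergence in `L²` gives almost everywhere convergence along a subsequence, which can be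
  -- compared with the pointwise sum of the series.
  have hlim := (tendstoInMeasure_of_tendsto_Lp hSf.tendsto_sum_nat).exists_seq_tendsto_ae
  obtain ⟨φ, hφ, hae⟩ := hlim
  have hfin : ∀ᵐ x ∂μ, ∀ N : ℕ, (∑ n ∈ Finset.range N,
      inner ℂ ((ha n).toLp (a n)) f • (hb n).toLp (b n) : Lp ℂ 2 μ) x =
      ∑ n ∈ Finset.range N, inner ℂ ((ha n).toLp (a n)) f * b n x := by
    rw [ae_all_iff]
    intro N
    induction N with
    | zero =>
      simp only [Finset.range_zero, Finset.sum_empty]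
      filter_upwards [Lp.coeFn_zero ℂ 2 μ] with x hx
      rw [hx, Pi.zero_apply]
    | succ N ih =>
      simp only [Finset.sum_range_succ]
      filter_upwards [ih, Lp.coeFn_add (∑ n ∈ Finset.range N,
        inner ℂ ((ha n).toLp (a n)) f • (hb n).toLp (b n) : Lp ℂ 2 μ)
        (inner ℂ ((ha N).toLp (a N)) f • (hb N).toLp (b N)),
        Lp.coeFn_smul (inner ℂ ((ha N).toLp (a N)) f) ((hb N).toLp (b N)),
        (hb N).coeFn_toLp] with x h1 h2 h3 h4
      rw [h2, Pi.add_apply, h1, h3, Pi.smul_apply, h4, smul_eq_mul]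
  have hgf : Integrable (fun y => g y * ‖f y‖) μ := hg.integrable_mul (Lp.memLp f).norm
  refine Lp.ext ?_
  have hag' : ∀ᵐ x ∂μ, ∀ n, ‖a n x‖ ≤ c n * g x := ae_all_iff.2 hag
  have hbg' : ∀ᵐ x ∂μ, ∀ n, ‖b n x‖ ≤ d n * g x := ae_all_iff.2 hbg
  filter_upwards [hae, hfin, integralOperator_ae hk f, hsum, hbg'] with x h1 h2 h3 h4 h5
  rw [h3]
  have hmain : HasSum (fun n => ∫ y, b n x * starRingEnd ℂ (a n y) * f y ∂μ)
      (∫ y, k x y * f y ∂μ) := by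
    have hint : ∀ n, Integrable (fun y => b n x * starRingEnd ℂ (a n y) * f y) μ := by
      intro n
      have := ((ha n).star.integrable_mul (Lp.memLp f)).const_mul (b n x)
      refine this.congr (Eventually.of_forall fun y => ?_)
      simp [mul_assoc]
    have hs : Summable fun n => ∫ y, ‖b n x * starRingEnd ℂ (a n y) * f y‖ ∂μ := by
      refine Summable.of_nonneg_of_le (fun n => integral_nonneg fun _ => norm_nonneg _)
        (fun n => ?_) (hcd.mul_left (g x * ∫ y, g y * ‖f y‖ ∂μ))
      calc ∫ y, ‖b n x * starRingEnd ℂ (a n y) * f y‖ ∂μ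
          ≤ ∫ y, (d n * g x * c n) * (g y * ‖f y‖) ∂μ := by
            refine integral_mono_ae (hint n).norm (hgf.const_mul _) ?_
            filter_upwards [hag'] with y hy
            rw [norm_mul, norm_mul, RCLike.norm_conj]
            calc _ ≤ (d n * g x) * (c n * g y) * ‖f y‖ := by
                  have := (norm_nonneg _).trans (h5 n)
                  gcongr
                  · exact h5 n
                  · exact hy n
              _ = _ := by ring
        _ = _ := by rw [integral_const_mul]; ring
    have h7 := hasSum_integral_of_summable_integral_norm hint hs
    have h8 : ∫ y, k x y * f y ∂μ =
        ∫ y, ∑' n, b n x * starRingEnd ℂ (a n y) * f y ∂μ := by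
      refine integral_congr_ae ?_
      filter_upwards [h4] with y hy
      rw [← hy.tsum_eq, tsum_mul_right]
    rwa [h8]
  have hmain' : HasSum (fun n => inner ℂ ((ha n).toLp (a n)) f * b n x)
      (∫ y, k x y * f y ∂μ) := by
    convert hmain using 2 with n
    rw [inner_toLp_eq, ← integral_mul_const]
    refine integral_congr_ae (Eventually.of_forall fun y => ?_)
    simp only
    ring
  have h6 := hmain'.tendsto_sum_nat.comp hφ.tendsto_atTop
  refine tendsto_nhds_unique h1 (h6.congr fun i => ?_)
  simp only [Function.comp]
  rw [h2]

end KernelExpansion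

/-! ### The matrix of the ASEP operator -/

/-- The Möbius map `ξ ↦ (ξ - p) / (q ξ)`: the pole of `K(ξ, ·)`. -/
noncomputable def asepMap (p q : ℝ) (ξ : ℂ) : ℂ := (ξ - p) / (q * ξ)

/-- The integrand of the matrix entries in the coordinate `w = log ξ`. -/
noncomputable def asepIntegrand (p q x t : ℝ) (j k : ℕ) (w : ℂ) : ℂ :=
  Complex.exp (w * (x - (j + 1))) * Complex.exp (asepEps p q (Complex.exp w) * t) *
    asepMap p q (Complex.exp w) ^ k

/-- The entries of the matrix of the ASEP operator with respect to the powers of `ξ`. -/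
noncomputable def asepEntry (p q x t R : ℝ) (j k : ℕ) : ℂ :=
  (2 * (π : ℂ) * q)⁻¹ * ∫ θ in (-π)..π, asepIntegrand p q x t j k (Real.log R + θ * Complex.I)

/-- The angle is moved to `(-π, π]` so that `log R + iθ` is the principal logarithm, the branch used
in `ξ^x`. -/
theorem integral_arcLength_eq_intervalIntegral {R : ℝ} (hR : 0 < R) (g : ℂ → ℂ)
    (hg : Measurable g) :
    ∫ ξ, g ξ ∂(arcLength R) =
      R * ∫ θ in (-π)..π, g (Complex.exp (Real.log R + θ * Complex.I)) := by
  have hper : Function.Periodic (fun θ : ℝ => g (circleMap 0 R θ)) (2 * π) := fun θ => by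
    simp only [periodic_circleMap 0 R θ]
  have h1 := hper.intervalIntegral_add_eq 0 (-π)
  unfold arcLength
  rw [integral_smul_measure,
    integral_map (continuous_circleMap 0 R).measurable.aemeasurable hg.aestronglyMeasurable,
    ← intervalIntegral.integral_of_le (by positivity), ENNReal.toReal_ofReal hR.le,
    Complex.real_smul]
  rw [zero_add] at h1
  rw [h1]
  congr 1
  rw [show -π + 2 * π = π by ring]
  refine intervalIntegral.integral_congr fun θ _ => ?_
  simp only [circleMap, zero_add]
  rw [Complex.exp_add, ← Complex.ofReal_exp, Real.exp_log hR]

theorem norm_asepMap_le {p q : ℝ} (hp : 0 ≤ p) (hq : 0 < q) {R : ℝ} (hR : 0 < R) {ξ : ℂ}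
    (hξ : ‖ξ‖ = R) : ‖asepMap p q ξ‖ ≤ (R + p) / (q * R) := by
  unfold asepMap
  rw [norm_div, norm_mul, hξ, Complex.norm_real, Real.norm_eq_abs, abs_of_pos hq]
  gcongr
  refine (norm_sub_le _ _).trans (le_of_eq ?_)
  simp [hξ, abs_of_nonneg hp]

/-- Geometric series in `M(ξ)/ξ'`. Its ratio is at most `(R + p)/(q R²)`, and this is below `1` by
the hypothesis on `R`. -/
theorem asepKernel_hasSum {p q : ℝ} (hp : 0 ≤ p) (hq : 0 < q) {R : ℝ} (hR : 0 < R)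
    (hpR : R + p < q * R ^ 2) (x t : ℝ) {ξ ξ' : ℂ} (hξ : ‖ξ‖ = R) (hξ' : ‖ξ'‖ = R) :
    HasSum (fun n : ℕ => (ξ ^ (x : ℂ) * Complex.exp (asepEps p q ξ * t) / (q * ξ) *
      asepMap p q ξ ^ n) * ((ξ' ^ n)⁻¹ / (2 * π * R)))
      (asepKernel p q x t ξ ξ' * (ξ' / (2 * π * R))) := by
  have h0 : ξ ≠ 0 := norm_pos_iff.1 (hξ ▸ hR)
  have h0' : ξ' ≠ 0 := norm_pos_iff.1 (hξ' ▸ hR)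
  have hq0 : (q : ℂ) ≠ 0 := by exact_mod_cast hq.ne'
  have hlt : ‖asepMap p q ξ / ξ'‖ < 1 := by
    rw [norm_div, hξ', div_lt_one hR]
    refine (norm_asepMap_le hp hq hR hξ).trans_lt ?_
    rw [div_lt_iff₀ (by positivity)]
    linarith
  have h1 : 1 - asepMap p q ξ / ξ' ≠ 0 := by
    intro h
    rw [← sub_eq_zero.1 h, norm_one] at hlt
    exact lt_irrefl _ hlt
  have hden : (p : ℂ) + q * ξ * ξ' - ξ = q * ξ * ξ' * (1 - asepMap p q ξ / ξ') := by
    unfold asepMap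
    field_simp
    ring
  have h2 := (hasSum_geometric_of_norm_lt_one hlt).mul_left
    (ξ ^ (x : ℂ) * Complex.exp (asepEps p q ξ * t) / (q * ξ) * (2 * (π : ℂ) * R)⁻¹)
  convert h2 using 1
  · rfl
  · funext n
    rw [div_pow]
    ring
  · unfold asepKernel
    rw [hden]
    field_simp

theorem exists_isNuclearRep_asepOperator {p q : ℝ} (hp : 0 ≤ p) (hq : 0 < q) {R : ℝ} (hR : 0 < R)
    (hpR : R + p < q * R ^ 2) (x t : ℝ) :
    ∃ a b : ℕ → Lp ℂ 2 (arcLength R), IsNuclearRep a b (asepOperator p q x t R) ∧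
      ∀ j k, inner ℂ (a j) (b k) = asepEntry p q x t R j k := by
  have hpi := Real.pi_pos
  set a : ℕ → ℂ → ℂ := fun n ξ => starRingEnd ℂ ((ξ ^ n)⁻¹ / (2 * π * R)) with ha_def
  set b : ℕ → ℂ → ℂ := fun n ξ => ξ ^ (x : ℂ) * Complex.exp (asepEps p q ξ * t) / (q * ξ) *
      asepMap p q ξ ^ n with hb_def
  have ham : ∀ n, Measurable (a n) := by
    intro n
    refine Complex.continuous_conj.measurable.comp ?_
    fun_prop
  have hbm : ∀ n, Measurable (b n) := by
    intro n
    simp only [hb_def, asepEps, asepMap]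
    fun_prop
  set D : ℝ := R ^ x * Real.exp ((p / R + q * R + 1) * |t|) / (q * R) with hD
  have hag : ∀ n, ∀ᵐ ξ ∂(arcLength R), ‖a n ξ‖ ≤ ((R ^ n)⁻¹ / (2 * π * R)) * 1 := by
    intro n
    filter_upwards [ae_norm_arcLength hR] with ξ hξ
    simp [ha_def, hξ, abs_of_pos hR, abs_of_pos hpi]
  have hbg : ∀ n, ∀ᵐ ξ ∂(arcLength R), ‖b n ξ‖ ≤ (D * ((R + p) / (q * R)) ^ n) * 1 := by
    intro n
    filter_upwards [ae_norm_arcLength hR] with ξ hξ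
    have h0 : ξ ≠ 0 := norm_pos_iff.1 (hξ ▸ hR)
    have e1 : ‖ξ ^ (x : ℂ)‖ = R ^ x := by
      rw [Complex.norm_cpow_of_ne_zero h0, hξ]
      simp
    have e2 : ‖Complex.exp (asepEps p q ξ * t)‖ ≤ Real.exp ((p / R + q * R + 1) * |t|) := by
      refine (Complex.norm_exp_le_exp_norm _).trans (Real.exp_le_exp.2 ?_)
      rw [norm_mul, Complex.norm_real, Real.norm_eq_abs]
      refine mul_le_mul_of_nonneg_right ?_ (abs_nonneg _)
      unfold asepEps
      refine (norm_sub_le _ _).trans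
        (add_le_add ((norm_add_le _ _).trans (le_of_eq ?_)) (by simp))
      simp [hξ, abs_of_nonneg hp, abs_of_pos hq, div_eq_mul_inv]
    have e3 : ‖(q : ℂ) * ξ‖ = q * R := by simp [hξ, abs_of_pos hq]
    simp only [hb_def, norm_mul, norm_div, norm_pow, mul_one] at e3 ⊢
    rw [e1, e3, hD]
    gcongr
    exact norm_asepMap_le hp hq hR hξ
  have ha : ∀ n, MemLp (a n) 2 (arcLength R) := fun n =>
    MemLp.of_bound (ham n).aestronglyMeasurable _ (hag n)
  have hb : ∀ n, MemLp (b n) 2 (arcLength R) := fun n =>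
    MemLp.of_bound (hbm n).aestronglyMeasurable _ (hbg n)
  refine ⟨fun n => (ha n).toLp (a n), fun n => (hb n).toLp (b n), ?_, ?_⟩
  · refine isNuclearRep_integralOperator (asepKernel_memLp hp hq hR hpR x t) (g := fun _ => 1)
      (c := fun n => (R ^ n)⁻¹ / (2 * π * R)) (d := fun n => D * ((R + p) / (q * R)) ^ n)
      (fun n => by positivity) (fun n => by positivity) ?_ ha hb (memLp_const 1) hag hbg ?_
    · have hlt : (R + p) / (q * R) / R < 1 := by
        rw [div_div, div_lt_one (by positivity)]
        linarith
      refine ((summable_geometric_of_lt_one (by positivity) hlt).mul_left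
        (D / (2 * π * R))).congr fun n => ?_
      rw [div_pow _ R]
      ring
    · filter_upwards [ae_norm_arcLength hR] with ξ hξ
      filter_upwards [ae_norm_arcLength hR] with ξ' hξ'
      simp only [ha_def, Complex.conj_conj]
      exact asepKernel_hasSum hp hq hR hpR x t hξ hξ'
  · intro j k
    rw [inner_toLp_eq]
    have h1 : ∫ ξ, starRingEnd ℂ (a j ξ) * (hb k).toLp (b k) ξ ∂(arcLength R) =
        ∫ ξ, (ξ ^ j)⁻¹ / (2 * π * R) * b k ξ ∂(arcLength R) := by
      refine integral_congr_ae ?_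
      filter_upwards [(hb k).coeFn_toLp] with ξ hξ
      simp only [hξ, ha_def, Complex.conj_conj]
    rw [h1, integral_arcLength_eq_intervalIntegral hR]
    · unfold asepEntry
      rw [← intervalIntegral.integral_const_mul, ← intervalIntegral.integral_const_mul,
        intervalIntegral.integral_of_le (by linarith), intervalIntegral.integral_of_le (by linarith)]
      refine setIntegral_congr_fun measurableSet_Ioc fun θ hθ => ?_
      have hR' : (R : ℂ) ≠ 0 := by exact_mod_cast hR.ne'
      have hpi' : (π : ℂ) ≠ 0 := by exact_mod_cast hpi.ne'
      have hq0 : (q : ℂ) ≠ 0 := by exact_mod_cast hq.ne'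
      -- This is where the range `(-π, π]` matters: the principal power `ξ^x` equals `e^(xw)`.
      have hlog : Complex.log (Complex.exp (Real.log R + θ * Complex.I)) =
          Real.log R + θ * Complex.I := by
        apply Complex.log_exp <;> simp [hθ.1, hθ.2]
      simp only [hb_def, asepIntegrand]
      rw [Complex.cpow_def_of_ne_zero (Complex.exp_ne_zero _), hlog]
      set w : ℂ := Real.log R + θ * Complex.I
      have e1 : Complex.exp (w * (x - (j + 1))) =
          Complex.exp (w * x) * (Complex.exp w ^ j)⁻¹ * (Complex.exp w)⁻¹ := by
        rw [← Complex.exp_nat_mul, ← Complex.exp_neg, ← Complex.exp_neg, ← Complex.exp_add,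
          ← Complex.exp_add]
        congr 1
        ring
      rw [e1]
      have := Complex.exp_ne_zero w
      field_simp
    · exact Measurable.mul (by fun_prop) (hbm k)

theorem isTraceClass_asepOperator_pow {p q : ℝ} (hp : 0 ≤ p) (hq : 0 < q) {R : ℝ} (hR : 0 < R)
    (hpR : R + p < q * R ^ 2) (x t : ℝ) (m : ℕ) :
    IsTraceClass (asepOperator p q x t R ^ (m + 1)) := by
  obtain ⟨a, b, h, -⟩ := exists_isNuclearRep_asepOperator hp hq hR hpR x t
  exact (h.pow_succ m).isTraceClass

theorem opTrace_asepOperator_pow {p q : ℝ} (hp : 0 ≤ p) (hq : 0 < q) {R : ℝ} (hR : 0 < R)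
    (hpR : R + p < q * R ^ 2) (x t : ℝ) (m : ℕ) :
    opTrace (asepOperator p q x t R ^ (m + 1)) =
      ∑' k, matrixIter (asepEntry p q x t R) m k k := by
  obtain ⟨a, b, h, hab⟩ := exists_isNuclearRep_asepOperator hp hq hR hpR x t
  rw [h.opTrace_pow_eq]
  simp only [hab]

/-! ### The growth function -/

/-- The growth function governing the entries of the matrix: `e ^ (t H(|ξ| - 1))` is a
supersolution for the ASEP operator. -/
noncomputable def growth (q B x : ℝ) : ℝ := q * x - q / B * Real.log (1 + B * x)

theorem growth_zero (q B : ℝ) : growth q B 0 = 0 := by simp [growth]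

theorem growth_le {q B x : ℝ} (hq : 0 ≤ q) (hB : 0 < B) (hx : 0 ≤ x) : growth q B x ≤ q * x := by
  have : 0 ≤ q / B * Real.log (1 + B * x) :=
    mul_nonneg (by positivity) (Real.log_nonneg (by nlinarith))
  unfold growth
  linarith

/-- The derivative of the growth function is `qBx/(1+Bx) ≤ qBx`; the integrated form follows from
`log u ≤ u - 1`. -/
theorem growth_add_le {q B x δ : ℝ} (hq : 0 ≤ q) (hB : 0 < B) (hx : 0 ≤ x) (hδ : 0 ≤ δ) :
    growth q B (x + δ) ≤ growth q B x + q * δ * B * (x + δ) := by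
  have h1 : 0 < 1 + B * x := by positivity
  have h2 : 0 < 1 + B * (x + δ) := by positivity
  have h3 : Real.log (1 + B * x) - Real.log (1 + B * (x + δ)) ≤
      (1 + B * x) / (1 + B * (x + δ)) - 1 := by
    rw [← Real.log_div h1.ne' h2.ne']
    exact Real.log_le_sub_one_of_pos (by positivity)
  have h4 : (1 + B * x) / (1 + B * (x + δ)) - 1 ≤ - (B * δ) + B * δ * (B * (x + δ)) := by
    rw [div_sub_one h2.ne', div_le_iff₀ h2]
    have : 0 ≤ B * δ * (B * (x + δ)) * (B * (x + δ)) := by positivity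
    nlinarith
  have h5 := mul_le_mul_of_nonneg_left (h3.trans h4) (by positivity : 0 ≤ q / B)
  have h6 : q / B * (- (B * δ) + B * δ * (B * (x + δ))) = - (q * δ) + q * δ * B * (x + δ) := by
    field_simp
  rw [h6] at h5
  unfold growth
  linarith

/-- With `s = √(1+Bx)`, `log(1+Bx) = 2 log s ≤ 2(s-1)`, so the growth function is at least
`(q/B)(s-1)²`, while `Bx = (s-1)(s+1)`. -/
theorem sq_le_growth {q B x X : ℝ} (hq : 0 ≤ q) (hB : 0 < B) (hx : 0 ≤ x) (hX : x ≤ X) :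
    q * B / (√(1 + B * X) + 1) ^ 2 * x ^ 2 ≤ growth q B x := by
  have h1 : 0 < 1 + B * x := by positivity
  set s := √(1 + B * x) with hs
  have hs0 : 0 < s := Real.sqrt_pos.2 h1
  have hs2 : s ^ 2 = 1 + B * x := Real.sq_sqrt h1.le
  have hsX : s ≤ √(1 + B * X) := Real.sqrt_le_sqrt (by nlinarith)
  have h2 : Real.log (1 + B * x) ≤ 2 * (s - 1) := by
    rw [← hs2, Real.log_pow]
    have := Real.log_le_sub_one_of_pos hs0
    push_cast
    linarith
  have h3 : q / B * (s - 1) ^ 2 ≤ growth q B x := by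
    have := mul_le_mul_of_nonneg_left h2 (by positivity : 0 ≤ q / B)
    have e : q * x = q / B * (s ^ 2 - 1) := by rw [hs2]; field_simp; ring
    unfold growth
    rw [e]
    nlinarith
  refine le_trans ?_ h3
  have hx' : x = (s - 1) * (s + 1) / B := by
    field_simp
    nlinarith
  have h4 : q * B / (√(1 + B * X) + 1) ^ 2 * x ^ 2 =
      q / B * (s - 1) ^ 2 * ((s + 1) ^ 2 / (√(1 + B * X) + 1) ^ 2) := by
    rw [hx']
    field_simp
  rw [h4]
  refine mul_le_of_le_one_right (by positivity) ?_
  rw [div_le_one (by positivity)]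
  gcongr

theorem growth_nonneg {q B x : ℝ} (hq : 0 ≤ q) (hB : 0 < B) (hx : 0 ≤ x) : 0 ≤ growth q B x :=
  le_trans (by positivity) (sq_le_growth hq hB hx le_rfl)

/-- The strict gain of the growth function along the Möbius map. -/
theorem exists_growth_gain {τ B X : ℝ} (hτ : 0 ≤ τ) (hB : 1 < B) (hBτ : 1 < B * (1 - τ))
    (hX : 0 ≤ X) : ∃ c > 0, ∀ x, 0 ≤ x → x ≤ X →
      c * x ^ 2 ≤ B * (1 - τ) * Real.log (1 + x) - Real.log (1 + B * x) +
        Real.log (1 + B * (τ * x / (1 + x))) := by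
  -- Since `1 + Bτx/(1+x) = (1+Cx)/(1+x)`, the right side is `A log(1+x) - log(1+Bx) + log(1+Cx)`.
  -- As `A = B - C`, its derivative vanishes at `0`.
  set C := 1 + B * τ with hC
  set A := B * (1 - τ) - 1 with hA
  have hC1 : 1 ≤ C := by rw [hC]; nlinarith
  have hA0 : 0 < A := by rw [hA]; linarith
  have hBC : A = B - C := by rw [hA, hC]; ring
  -- Half of a lower bound, uniform on `[0, X]`, for the derivative divided by `z`; the half
  -- compensates the `2` in the derivative of `c z²`.
  set c := A * (B + C - 1) / ((1 + X) * (1 + B * X) * (1 + C * X)) / 2 with hc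
  have hB0 : 0 < B := by linarith
  have hC0 : 0 < C := by linarith
  have hBC1 : 0 < B + C - 1 := by linarith
  refine ⟨c, by positivity, fun x hx0 hxX => ?_⟩
  set f : ℝ → ℝ := fun x => A * Real.log (1 + x) - Real.log (1 + B * x) + Real.log (1 + C * x) -
    c * x ^ 2 with hf
  have hd : ∀ z, 0 ≤ z → HasDerivAt f (A * (1 / (1 + z)) - B / (1 + B * z) + C / (1 + C * z) -
      c * (2 * z)) z := by
    intro z hz
    have d : ∀ b : ℝ, 0 < b → HasDerivAt (fun z => Real.log (1 + b * z)) (b / (1 + b * z)) z := by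
      intro b hb
      have : HasDerivAt (fun z => 1 + b * z) b z := by
        simpa using ((hasDerivAt_id z).const_mul b).const_add 1
      exact this.log (by positivity)
    have d1 := d 1 one_pos
    simp only [one_mul] at d1
    have d2 : HasDerivAt (fun z : ℝ => c * z ^ 2) (c * (2 * z)) z := by
      simpa using (hasDerivAt_pow 2 z).const_mul c
    exact (((d1.const_mul A).sub (d B hB0)).add (d C hC0)).sub d2
  have hmono : MonotoneOn f (Set.Icc 0 X) := by
    refine monotoneOn_of_deriv_nonneg (convex_Icc 0 X)
      (fun z hz => (hd z hz.1).continuousAt.continuousWithinAt) ?_ ?_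
    · intro z hz
      rw [interior_Icc] at hz
      exact (hd z hz.1.le).differentiableAt.differentiableWithinAt
    · intro z hz
      rw [interior_Icc] at hz
      rw [(hd z hz.1.le).deriv]
      have hz0 := hz.1
      have e : A * (1 / (1 + z)) - B / (1 + B * z) + C / (1 + C * z) =
          A * z * (B + C - 1 + B * C * z) / ((1 + z) * (1 + B * z) * (1 + C * z)) := by
        rw [hBC]
        field_simp
        ring
      rw [e, sub_nonneg]
      calc c * (2 * z) = A * z * (B + C - 1) / ((1 + X) * (1 + B * X) * (1 + C * X)) := by
            rw [hc]; ring
        _ ≤ _ := by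
            have hzX := hz.2.le
            gcongr
            have : 0 < B * C * z := by positivity
            linarith
  have h0 := hmono ⟨le_rfl, hX⟩ ⟨hx0, hxX⟩ hx0
  have hf0 : f 0 = 0 := by simp [hf]
  rw [hf0] at h0
  have e1 : 1 + B * (τ * x / (1 + x)) = (1 + C * x) / (1 + x) := by
    rw [hC]
    field_simp
    ring
  rw [e1, Real.log_div (by positivity) (by positivity)]
  simp only [hf, hA] at h0
  linarith

/-! ### Weights -/

/-- The weight `min_{1 ≤ r ≤ R} e ^ (t H(r - 1)) r ^ (-j)`. -/
noncomputable def asepWeight (q B R t : ℝ) (j : ℕ) : ℝ :=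
  sInf ((fun r : ℝ => Real.exp (t * growth q B (r - 1)) * (r ^ j)⁻¹) '' Set.Icc 1 R)

theorem continuousOn_weightFun {q B R t : ℝ} (hB : 0 < B) (j : ℕ) :
    ContinuousOn (fun r : ℝ => Real.exp (t * growth q B (r - 1)) * (r ^ j)⁻¹) (Set.Icc 1 R) := by
  unfold growth
  refine ContinuousOn.mul (ContinuousOn.rexp (ContinuousOn.mul (by fun_prop)
    (ContinuousOn.sub (by fun_prop) (ContinuousOn.mul (by fun_prop)
      (ContinuousOn.log (by fun_prop) ?_))))) (ContinuousOn.inv₀ (by fun_prop) ?_)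
  · intro r hr
    have : 0 ≤ B * (r - 1) := mul_nonneg hB.le (by linarith [hr.1])
    linarith
  · intro r hr
    have : 0 < r := by linarith [hr.1]
    positivity

theorem exists_asepWeight_eq {q B R t : ℝ} (hB : 0 < B) (hR : 1 ≤ R) (j : ℕ) :
    ∃ r ∈ Set.Icc 1 R, asepWeight q B R t j = Real.exp (t * growth q B (r - 1)) * (r ^ j)⁻¹ := by
  have := (isCompact_Icc.image_of_continuousOn
    (continuousOn_weightFun (q := q) (R := R) (t := t) hB j)).sInf_mem
    ((Set.nonempty_Icc.2 hR).image _)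
  obtain ⟨r, hr, h⟩ := this
  exact ⟨r, hr, h.symm⟩

theorem asepWeight_le {q B R t : ℝ} (hB : 0 < B) (j : ℕ) {r : ℝ} (hr : r ∈ Set.Icc 1 R) :
    asepWeight q B R t j ≤ Real.exp (t * growth q B (r - 1)) * (r ^ j)⁻¹ :=
  csInf_le (isCompact_Icc.image_of_continuousOn
    (continuousOn_weightFun (q := q) (R := R) (t := t) hB j)).bddBelow ⟨r, hr, rfl⟩

theorem asepWeight_pos {q B R t : ℝ} (hB : 0 < B) (hR : 1 ≤ R) (j : ℕ) :
    0 < asepWeight q B R t j := by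
  obtain ⟨r, hr, h⟩ := exists_asepWeight_eq (q := q) (t := t) hB hR j
  have : 0 < r := by linarith [hr.1]
  rw [h]
  positivity

theorem asepWeight_le_one {q B R t : ℝ} (hB : 0 < B) (hR : 1 ≤ R) (j : ℕ) :
    asepWeight q B R t j ≤ 1 := by
  have := asepWeight_le (q := q) (t := t) hB j (Set.left_mem_Icc.2 hR)
  simpa [growth_zero] using this

/-- The weights with index of order `√t` stay away from `0`. -/
theorem exists_le_asepWeight {q B R : ℝ} (hq : 0 < q) (hB : 0 < B) (hR : 1 ≤ R) (s : ℝ) :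
    ∃ c > 0, ∀ t > 0, ∀ j : ℕ, (j : ℝ) ≤ s * √t → c ≤ asepWeight q B R t j := by
  -- By the quadratic lower bound for the growth function, the exponent is at least `t d (r-1)² -
  -- s√t (r-1)`; completing the square bounds this below by `-s²/(4d)`.
  set d := q * B / (√(1 + B * (R - 1)) + 1) ^ 2 with hd
  have hd0 : 0 < d := by positivity
  refine ⟨Real.exp (-(s ^ 2 / (4 * d))), Real.exp_pos _, fun t ht j hj => ?_⟩
  obtain ⟨r, hr, h⟩ := exists_asepWeight_eq (q := q) (t := t) hB hR j
  have hr0 : 0 < r := by linarith [hr.1]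
  have hs2 : √t ^ 2 = t := Real.sq_sqrt ht.le
  have hs0 : 0 < √t := Real.sqrt_pos.2 ht
  rw [h, ← Real.exp_log hr0, ← Real.exp_nat_mul, ← Real.exp_neg, ← Real.exp_add, Real.exp_log hr0]
  refine Real.exp_le_exp.2 ?_
  have h1 := sq_le_growth (x := r - 1) hq.le hB (by linarith [hr.1])
    (by linarith [hr.2] : r - 1 ≤ R - 1)
  rw [← hd] at h1
  have h2 : Real.log r ≤ r - 1 := Real.log_le_sub_one_of_pos hr0
  have h3 : (j : ℝ) * Real.log r ≤ s * √t * (r - 1) := by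
    have := Real.log_nonneg hr.1
    have := hr.1
    calc (j : ℝ) * Real.log r ≤ j * (r - 1) := by gcongr
      _ ≤ _ := mul_le_mul_of_nonneg_right hj (by linarith)
  have h4 : t * (d * (r - 1) ^ 2) ≤ t * growth q B (r - 1) := mul_le_mul_of_nonneg_left h1 ht.le
  have h5 : 0 ≤ t * (d * (r - 1) ^ 2) - s * √t * (r - 1) + s ^ 2 / (4 * d) := by
    have : t * (d * (r - 1) ^ 2) - s * √t * (r - 1) + s ^ 2 / (4 * d) =
        d * (√t * (r - 1) - s / (2 * d)) ^ 2 := by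
      rw [← hs2, Real.sqrt_sq hs0.le]
      field_simp
      ring
    rw [this]
    positivity
  linarith

/-! ### Geometry of the Möbius map -/

section Geometry

variable {p q : ℝ} (hp : 0 ≤ p) (hpq : p < q) (hsum : p + q = 1)

theorem asepMap_eq {p q : ℝ} (hq : q ≠ 0) {ξ : ℂ} (hξ : ξ ≠ 0) :
    asepMap p q ξ = (1 - p * ξ⁻¹) / q := by
  have : (q : ℂ) ≠ 0 := by exact_mod_cast hq
  unfold asepMap
  field_simp

theorem asepMap_re {p q : ℝ} (hq : q ≠ 0) {ξ : ℂ} (hξ : ξ ≠ 0) :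
    (asepMap p q ξ).re = (1 - p * (ξ.re / ‖ξ‖ ^ 2)) / q := by
  rw [asepMap_eq hq hξ, Complex.div_ofReal_re]
  simp [Complex.inv_re, Complex.normSq_eq_norm_sq]

theorem asepMap_im {p q : ℝ} (hq : q ≠ 0) {ξ : ℂ} (hξ : ξ ≠ 0) :
    (asepMap p q ξ).im = p * (ξ.im / ‖ξ‖ ^ 2) / q := by
  rw [asepMap_eq hq hξ, Complex.div_ofReal_im]
  simp [Complex.inv_im, Complex.normSq_eq_norm_sq, neg_div]

/-- The exponent is a difference of the coordinate before and after the Möbius map. This makes the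
linear part `qx` of the growth function telescope. -/
theorem asepEps_eq {p q : ℝ} (hq : q ≠ 0) {ξ : ℂ} (hξ : ξ ≠ 0) :
    asepEps p q ξ = q * (ξ - asepMap p q ξ) := by
  have : (q : ℂ) ≠ 0 := by exact_mod_cast hq
  rw [asepMap_eq hq hξ, asepEps]
  field_simp
  ring

theorem asepEps_re {p q : ℝ} (hq : q ≠ 0) {ξ : ℂ} (hξ : ξ ≠ 0) :
    (asepEps p q ξ).re = q * (ξ.re - (asepMap p q ξ).re) := by
  rw [asepEps_eq hq hξ]
  simp

include hp hpq hsum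

/-- `q M = 1 - p/ξ` and `Re(1/ξ) ≤ 1`, with `1 - p = q`. In particular the exterior of the unit disc
is invariant under the map. -/
theorem one_le_asepMap_re {ξ : ℂ} (hξ : 1 ≤ ‖ξ‖) : 1 ≤ (asepMap p q ξ).re := by
  have hq : 0 < q := by linarith
  have h0 : ξ ≠ 0 := norm_pos_iff.1 (by linarith)
  rw [asepMap_re hq.ne' h0, le_div_iff₀ hq]
  have h1 : ξ.re / ‖ξ‖ ^ 2 ≤ 1 := by
    rw [div_le_one (by positivity)]
    have := Complex.re_le_norm ξ
    nlinarith
  nlinarith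

theorem one_le_norm_asepMap {ξ : ℂ} (hξ : 1 ≤ ‖ξ‖) : 1 ≤ ‖asepMap p q ξ‖ :=
  (one_le_asepMap_re hp hpq hsum hξ).trans (Complex.re_le_norm _)

/-- Contraction of the deviation from the positive axis: `(|M| - Re M)(|M| + Re M) = (Im M)²`, the
second factor is at least `2`, and `(Im M)² ≤ 2 (p/q)² (|ξ| - Re ξ)`. -/
theorem norm_asepMap_sub_re_le {ξ : ℂ} (hξ : 1 ≤ ‖ξ‖) :
    ‖asepMap p q ξ‖ - (asepMap p q ξ).re ≤ (p / q) ^ 2 * (‖ξ‖ - ξ.re) := by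
  have hq : 0 < q := by linarith
  have h0 : ξ ≠ 0 := norm_pos_iff.1 (by linarith)
  have h1 := one_le_asepMap_re hp hpq hsum hξ
  have h2 := one_le_norm_asepMap hp hpq hsum hξ
  have h3 : ‖asepMap p q ξ‖ ^ 2 = (asepMap p q ξ).re ^ 2 + (asepMap p q ξ).im ^ 2 := by
    rw [← Complex.normSq_eq_norm_sq, Complex.normSq_apply]; ring
  have h4 : ‖ξ‖ ^ 2 = ξ.re ^ 2 + ξ.im ^ 2 := by
    rw [← Complex.normSq_eq_norm_sq, Complex.normSq_apply]; ring
  set r := ‖ξ‖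
  have hre : ξ.re ≤ r := Complex.re_le_norm ξ
  have h5 : (asepMap p q ξ).im ^ 2 ≤ (p / q) ^ 2 * (2 * (r - ξ.re)) := by
    have e : (asepMap p q ξ).im ^ 2 = (p / q) ^ 2 * (ξ.im ^ 2 / r ^ 4) := by
      rw [asepMap_im hq.ne' h0]
      field_simp
      rfl
    rw [e]
    refine mul_le_mul_of_nonneg_left ?_ (by positivity)
    rw [div_le_iff₀ (by positivity)]
    have e2 : ξ.im ^ 2 = (r - ξ.re) * (r + ξ.re) := by nlinarith
    rw [e2]
    have h6 : r ≤ r ^ 4 := le_self_pow₀ hξ (by norm_num)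
    have h7 : 0 ≤ r - ξ.re := by linarith
    nlinarith
  have h6 : 0 ≤ (p / q) ^ 2 * (r - ξ.re) := mul_nonneg (by positivity) (by linarith)
  by_contra! hcon
  nlinarith

/-- The supersolution property of the growth function away from the negative half plane. -/
theorem asepEps_re_add_growth_le {B c X : ℝ} (hB : 1 < B)
    (hc : ∀ x, 0 ≤ x → x ≤ X → c * x ^ 2 ≤ B * (1 - p / q) * Real.log (1 + x) -
      Real.log (1 + B * x) + Real.log (1 + B * (p / q * x / (1 + x))))
    {ξ : ℂ} (hξ : 1 ≤ ‖ξ‖) (hX : ‖ξ‖ - 1 ≤ X) :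
    (asepEps p q ξ).re + growth q B (‖asepMap p q ξ‖ - 1) - (q - p) * Real.log ‖ξ‖ ≤
      growth q B (‖ξ‖ - 1) - q / B * c * (‖ξ‖ - 1) ^ 2 -
        q * (1 - (p / q) ^ 2) * (‖ξ‖ - ξ.re) := by
  have hq : 0 < q := by linarith
  have h0 : ξ ≠ 0 := norm_pos_iff.1 (by linarith)
  have h1 := norm_asepMap_sub_re_le hp hpq hsum hξ
  -- The left side is the value of the map at the positive point `|ξ|`. Only this lower bound on
  -- `|M|` is needed, because it enters the logarithm with a minus sign.
  have h2 : 1 + p / q * (‖ξ‖ - 1) / (1 + (‖ξ‖ - 1)) ≤ ‖asepMap p q ξ‖ := by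
    refine le_trans ?_ (Complex.re_le_norm _)
    rw [asepMap_re hq.ne' h0]
    have h3 : p * (ξ.re / ‖ξ‖ ^ 2) ≤ p / ‖ξ‖ := by
      rw [div_eq_mul_inv p]
      refine mul_le_mul_of_nonneg_left ?_ hp
      rw [div_le_iff₀ (by positivity)]
      have : ‖ξ‖⁻¹ * ‖ξ‖ ^ 2 = ‖ξ‖ := by field_simp
      rw [this]
      exact Complex.re_le_norm ξ
    have h4 : 1 + p / q * (‖ξ‖ - 1) / (1 + (‖ξ‖ - 1)) = (1 - p / ‖ξ‖) / q := by
      have : ‖ξ‖ ≠ 0 := by positivity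
      have e : 1 + (‖ξ‖ - 1) = ‖ξ‖ := by ring
      rw [e]
      field_simp
      have : q = 1 - p := by linarith
      rw [this]; ring
    rw [h4]
    gcongr
  have h3 := hc (‖ξ‖ - 1) (by linarith) hX
  have h4 : Real.log (1 + B * (p / q * (‖ξ‖ - 1) / (1 + (‖ξ‖ - 1)))) ≤
      Real.log (1 + B * (‖asepMap p q ξ‖ - 1)) := by
    have : 0 ≤ p / q * (‖ξ‖ - 1) / (1 + (‖ξ‖ - 1)) :=
      div_nonneg (mul_nonneg (by positivity) (by linarith)) (by linarith)
    refine Real.log_le_log (by positivity) ?_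
    gcongr
    linarith
  have h5 : c * (‖ξ‖ - 1) ^ 2 ≤ B * (1 - p / q) * Real.log ‖ξ‖ -
      Real.log (1 + B * (‖ξ‖ - 1)) + Real.log (1 + B * (‖asepMap p q ξ‖ - 1)) := by
    rw [show 1 + (‖ξ‖ - 1) = ‖ξ‖ by ring] at h3 h4
    linarith
  have h6 := mul_le_mul_of_nonneg_left h5 (by positivity : 0 ≤ q / B)
  have h7 : q / B * (B * (1 - p / q) * Real.log ‖ξ‖) = (q - p) * Real.log ‖ξ‖ := by field_simp
  have h8 := mul_le_mul_of_nonneg_left h1 hq.le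
  -- The linear parts combine to `q(|ξ|-1) - q(|ξ| - Re ξ) + q(|M| - Re M)`; the contraction bounds
  -- the last term and the gain inequality handles the logarithms.
  rw [asepEps_re hq.ne' h0]
  unfold growth
  nlinarith

/-- On the unit circle this gives `|M| - 1 ≤ 2(1 - cos θ)`, so powers `M^k` with `k` of order `√t`
cannot offset the decay `e^(-t(1 - cos θ))`. -/
theorem norm_asepMap_sub_one_le {ξ : ℂ} (hξ : 1 ≤ ‖ξ‖) :
    ‖asepMap p q ξ‖ - 1 ≤ (‖ξ‖ - 1) + 2 * (‖ξ‖ - ξ.re) := by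
  have hq : 0 < q := by linarith
  have h0 : ξ ≠ 0 := norm_pos_iff.1 (by linarith)
  have h1 := norm_asepMap_sub_re_le hp hpq hsum hξ
  have hu : 0 ≤ ‖ξ‖ - ξ.re := sub_nonneg.2 (Complex.re_le_norm ξ)
  have hτ : p / q ≤ 1 := (div_le_one hq).2 hpq.le
  have hτ0 : 0 ≤ p / q := by positivity
  have h2 : (p / q) ^ 2 * (‖ξ‖ - ξ.re) ≤ ‖ξ‖ - ξ.re :=
    mul_le_of_le_one_left hu (by nlinarith)
  have h3 : (asepMap p q ξ).re - 1 ≤ (‖ξ‖ - 1) + (‖ξ‖ - ξ.re) := by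
    rw [asepMap_re hq.ne' h0]
    have e : (1 - p * (ξ.re / ‖ξ‖ ^ 2)) / q - 1 = p / q * ((‖ξ‖ ^ 2 - ξ.re) / ‖ξ‖ ^ 2) := by
      field_simp
      have : q = 1 - p := by linarith
      rw [this]; ring
    rw [e]
    have h4 : (‖ξ‖ ^ 2 - ξ.re) / ‖ξ‖ ^ 2 ≤ (‖ξ‖ - 1) + (‖ξ‖ - ξ.re) := by
      rw [div_le_iff₀ (by positivity)]
      have : ‖ξ‖ ≤ ‖ξ‖ ^ 2 := le_self_pow₀ hξ (by norm_num)
      nlinarith [sq_nonneg (‖ξ‖ - 1)]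
    have h5 : 0 ≤ (‖ξ‖ - 1) + (‖ξ‖ - ξ.re) := by linarith
    nlinarith
  linarith

/-- Exponential decay over the negative half plane. -/
theorem asepEps_re_add_growth_le_of_re_nonpos {B : ℝ} (hB : 0 < B) {ξ : ℂ} (hξ : 1 ≤ ‖ξ‖)
    (hre : ξ.re ≤ 0) :
    (asepEps p q ξ).re + growth q B (‖asepMap p q ξ‖ - 1) ≤ -(q - p) := by
  have hq : 0 < q := by linarith
  have h0 : ξ ≠ 0 := norm_pos_iff.1 (by linarith)
  have h1 := one_le_norm_asepMap hp hpq hsum hξ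
  -- The linear bound suffices here: the left side is at most `q Re ξ + q(|M| - Re M) - q`, and `|M|
  -- - Re M ≤ |Im M| ≤ p/q`.
  have h2 := growth_le (x := ‖asepMap p q ξ‖ - 1) hq.le hB (by linarith)
  have h3 : ‖asepMap p q ξ‖ ≤ (asepMap p q ξ).re + p / q := by
    have a1 := Complex.norm_le_abs_re_add_abs_im (asepMap p q ξ)
    rw [abs_of_nonneg (zero_le_one.trans (one_le_asepMap_re hp hpq hsum hξ))] at a1
    have a2 : |(asepMap p q ξ).im| ≤ p / q := by
      rw [asepMap_im hq.ne' h0, abs_div, abs_of_pos hq, abs_mul, abs_of_nonneg hp]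
      refine div_le_div_of_nonneg_right (mul_le_of_le_one_right hp ?_) hq.le
      rw [abs_div, abs_of_nonneg (sq_nonneg ‖ξ‖), div_le_one (by positivity)]
      have := Complex.abs_im_le_norm ξ
      nlinarith
    linarith
  have h4 : q * (‖asepMap p q ξ‖ - (asepMap p q ξ).re) ≤ p := by
    have := mul_le_mul_of_nonneg_left (sub_le_iff_le_add'.2 h3) hq.le
    rwa [mul_div_cancel₀ _ hq.ne'] at this
  rw [asepEps_re hq.ne' h0]
  nlinarith

theorem one_lt_radius {R : ℝ} (hR : 0 < R) (hpR : R + p < q * R ^ 2) : 1 < R := by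
  have hq : 0 < q := by linarith
  have h1 : 1 < q * R := by
    by_contra! h
    nlinarith
  nlinarith

end Geometry

/-- `q²|M|² = 1 - 2p Re(1/ξ) + p²/|ξ|²`, and the middle term helps when `Re ξ ≥ 0`. Together with
the next inequality this keeps `|M|` uniformly below `R`, at every radius `|ξ| ≥ 1`. -/
theorem norm_asepMap_le_of_re_nonneg {p q : ℝ} (hp : 0 ≤ p) (hpq : p < q) {ξ : ℂ} (hξ : 1 ≤ ‖ξ‖) (hre : 0 ≤ ξ.re) :
    ‖asepMap p q ξ‖ ≤ √(1 + p ^ 2) / q := by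
  have hq : 0 < q := by linarith
  have h0 : ξ ≠ 0 := norm_pos_iff.1 (by linarith)
  rw [le_div_iff₀ hq]
  refine Real.le_sqrt_of_sq_le ?_
  have h3 : ‖asepMap p q ξ‖ ^ 2 = (asepMap p q ξ).re ^ 2 + (asepMap p q ξ).im ^ 2 := by
    rw [← Complex.normSq_eq_norm_sq, Complex.normSq_apply]; ring
  have h4 : ‖ξ‖ ^ 2 = ξ.re ^ 2 + ξ.im ^ 2 := by
    rw [← Complex.normSq_eq_norm_sq, Complex.normSq_apply]; ring
  rw [mul_pow, h3, asepMap_re hq.ne' h0, asepMap_im hq.ne' h0]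
  have e : (((1 - p * (ξ.re / ‖ξ‖ ^ 2)) / q) ^ 2 + (p * (ξ.im / ‖ξ‖ ^ 2) / q) ^ 2) * q ^ 2 =
      1 - 2 * p * (ξ.re / ‖ξ‖ ^ 2) + p ^ 2 * ((ξ.re ^ 2 + ξ.im ^ 2) / ‖ξ‖ ^ 4) := by
    field_simp
    ring
  rw [e, ← h4]
  have h5 : ‖ξ‖ ^ 2 / ‖ξ‖ ^ 4 ≤ 1 := by
    rw [div_le_one (by positivity)]
    exact pow_le_pow_right₀ hξ (by norm_num)
  have h6 : 0 ≤ p * (ξ.re / ‖ξ‖ ^ 2) := by positivity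
  nlinarith [sq_nonneg p]

/-- For `z = qR` the hypothesis reads `z² > z + pq`. Hence `z > 1`, and `pq ≥ p²` gives `z² > 1 +
p²`. -/
theorem sqrt_one_add_sq_div_lt {p q : ℝ} (hp : 0 ≤ p) (hpq : p < q) {R : ℝ} (hR : 0 < R)
    (hpR : R + p < q * R ^ 2) :
    √(1 + p ^ 2) / q < R := by
  have hq : 0 < q := by linarith
  rw [div_lt_iff₀ hq, Real.sqrt_lt' (by positivity)]
  set z := q * R with hz
  have hz0 : 0 < z := by positivity
  have h1 : z + p * q < z ^ 2 := by
    rw [hz]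
    nlinarith
  rw [mul_comm R q, ← hz]
  have h2 : 1 < z := by nlinarith [mul_nonneg hp hq.le]
  nlinarith [mul_nonneg hp hq.le, mul_nonneg hp (sub_nonneg.2 hpq.le)]

/-! ### Bounds for the matrix entries -/

/-- The scaling `x(t) = (p - q) t + (q - p) y √t`. -/
noncomputable def asepSite (p q y t : ℝ) : ℝ := (p - q) * t + (q - p) * y * √t

/-- The minimum defining the weight is tested at `r = ρ e^(1/√t)`, slightly beyond `ρ`. The extra
factor yields the decay `e^(-k/√t)`, at the cost of an exponent of order `√t(ρ-1) + 1`. -/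
theorem pow_le_div_asepWeight {q B R t : ℝ} (hq : 0 < q) (hB : 0 < B) (hR : 1 ≤ R) (ht : 1 ≤ t)
    {ρ : ℝ} (hρ : 1 ≤ ρ) (hρR : ρ * Real.exp (1 / √t) ≤ R) (k : ℕ) :
    ρ ^ k ≤ Real.exp (t * growth q B (ρ - 1) + 2 * q * B * R * √t * (ρ - 1) + 4 * q * B * R ^ 2) *
      (Real.exp (-(k / √t)) / asepWeight q B R t k) := by
  have hs : 1 ≤ √t := Real.one_le_sqrt.2 ht
  have hs2 : √t ^ 2 = t := Real.sq_sqrt (by linarith)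
  set s := √t
  set η := 1 / s with hη
  have hη0 : 0 < η := by positivity
  have hη1 : η ≤ 1 := (div_le_one (by linarith)).2 hs
  have hw := asepWeight_pos (q := q) (t := t) hB hR k
  have h1 : Real.exp η - 1 ≤ 2 * η := by
    have := Real.abs_exp_sub_one_le (x := η) (by rwa [abs_of_pos hη0])
    rw [abs_of_pos hη0] at this
    exact (le_abs_self _).trans this
  have h1' : 1 ≤ Real.exp η := Real.one_le_exp hη0.le
  have hρe : ρ ≤ ρ * Real.exp η := le_mul_of_one_le_right (by linarith) h1'
  have hρR' : ρ ≤ R := hρe.trans hρR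
  set δ := ρ * Real.exp η - ρ with hδ
  have hδ0 : 0 ≤ δ := by linarith
  have hδ1 : δ ≤ 2 * R * η := by
    have : δ = ρ * (Real.exp η - 1) := by rw [hδ]; ring
    rw [this]
    calc ρ * (Real.exp η - 1) ≤ R * (2 * η) := by gcongr
      _ = _ := by ring
  have h2 := asepWeight_le (q := q) (t := t) hB k (r := ρ * Real.exp η) ⟨by linarith, hρR⟩
  have h3 := growth_add_le (q := q) (x := ρ - 1) hq.le hB (by linarith) hδ0
  have h4 : t * growth q B (ρ * Real.exp η - 1) ≤
      t * growth q B (ρ - 1) + 2 * q * B * R * s * (ρ - 1) + 4 * q * B * R ^ 2 := by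
    have e : ρ * Real.exp η - 1 = ρ - 1 + δ := by rw [hδ]; ring
    rw [e]
    have h5 : t * (q * δ * B * (ρ - 1 + δ)) ≤
        2 * q * B * R * s * (ρ - 1) + 4 * q * B * R ^ 2 := by
      calc t * (q * δ * B * (ρ - 1 + δ))
          ≤ t * (q * (2 * R * η) * B * (ρ - 1 + 2 * R * η)) := by
            have : 0 ≤ ρ - 1 := by linarith
            gcongr
        _ = _ := by
            rw [← hs2, hη]
            field_simp
            ring
    nlinarith
  have hη' : (k : ℝ) / s = k * η := by rw [hη]; ring
  rw [← mul_div_assoc, le_div_iff₀ hw, hη']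
  calc ρ ^ k * asepWeight q B R t k
      ≤ ρ ^ k * (Real.exp (t * growth q B (ρ * Real.exp η - 1)) * ((ρ * Real.exp η) ^ k)⁻¹) := by
        gcongr
    _ = Real.exp (t * growth q B (ρ * Real.exp η - 1)) * Real.exp (-(k * η)) := by
        have : ρ ^ k ≠ 0 := by positivity
        rw [mul_pow, ← Real.exp_nat_mul, Real.exp_neg]
        field_simp
    _ ≤ _ := by gcongr

section Bounds

variable {p q : ℝ} (hp : 0 ≤ p) (hpq : p < q) (hsum : p + q = 1) (y : ℝ) {R : ℝ} (hR : 0 < R)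
  (hpR : R + p < q * R ^ 2)

theorem eventually_mul_exp_le {ρ : ℝ} (hρ : ρ < R) :
    ∀ᶠ t in atTop, ρ * Real.exp (1 / √t) ≤ R := by
  have h1 : Tendsto (fun t : ℝ => ρ * Real.exp (1 / √t)) atTop (𝓝 (ρ * Real.exp 0)) := by
    refine Tendsto.const_mul _ ((Real.continuous_exp.tendsto 0).comp ?_)
    simpa [Function.comp_def] using tendsto_inv_atTop_zero.comp Real.tendsto_sqrt_atTop
  rw [Real.exp_zero, mul_one] at h1
  exact h1.eventually_le_const hρ

include hp hpq hsum hR hpR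

/-- The drift `(p-q)t log|ξ|` of the site is exactly the logarithm in the supersolution inequality.
The remaining errors, of order `√t(|ξ|-1)` and `√t(|ξ| - Re ξ)`, are absorbed by its quadratic and
linear gains. -/
theorem exists_bound_right {B : ℝ} (hB : 1 < B) (hBτ : 1 < B * (1 - p / q)) :
    ∃ C > 0, ∃ κ > 0, ∀ᶠ t in atTop, ∀ (k : ℕ) (ξ : ℂ), 1 ≤ ‖ξ‖ → ‖ξ‖ ≤ R → 0 ≤ ξ.re →
      Real.exp (asepSite p q y t * Real.log ‖ξ‖ + t * (asepEps p q ξ).re) * ‖asepMap p q ξ‖ ^ k ≤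
        C * Real.exp (t * growth q B (‖ξ‖ - 1)) *
          (Real.exp (-(k / √t)) / asepWeight q B R t k) *
            Real.exp (-(κ * t * (‖ξ‖ - ξ.re))) := by
  have hq : 0 < q := by linarith
  have hR1 := one_lt_radius hp hpq hsum hR hpR
  have hB0 : 0 < B := by linarith
  have hτ1 : p / q < 1 := (div_lt_one hq).2 hpq
  have hτ0 : 0 ≤ p / q := by positivity
  obtain ⟨c, hc, hgain⟩ := exists_growth_gain (X := R - 1) hτ0 hB hBτ (by linarith)
  set C1 := 2 * q * B * R with hC1
  have hC10 : 0 < C1 := by positivity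
  set d := q / B * c with hd
  have hd0 : 0 < d := by positivity
  set κ0 := q * (1 - (p / q) ^ 2) with hκ0
  have hκ00 : 0 < κ0 := mul_pos hq (by nlinarith)
  set C3 := (q - p) * |y| + C1 with hC3
  -- `C3²/(4d)` comes from completing the square in `√t(|ξ|-1)`. Half of the rate `κ0` is spent on
  -- the term `2 C1 √t u`, which is allowed once `√t ≥ 4 C1/κ0`.
  refine ⟨Real.exp (4 * q * B * R ^ 2 + C3 ^ 2 / (4 * d)), Real.exp_pos _, κ0 / 2, by positivity, ?_⟩
  filter_upwards [eventually_mul_exp_le (sqrt_one_add_sq_div_lt hp hpq hR hpR),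
    eventually_ge_atTop 1, eventually_ge_atTop ((4 * C1 / κ0) ^ 2)] with t ht1 ht2 ht3 k ξ h1 h2 h3
  have hs : 1 ≤ √t := Real.one_le_sqrt.2 ht2
  have hs2 : √t ^ 2 = t := Real.sq_sqrt (by linarith)
  have hs3 : 4 * C1 / κ0 ≤ √t := Real.le_sqrt_of_sq_le ht3
  have hρ1 := one_le_norm_asepMap hp hpq hsum h1
  have hρR : ‖asepMap p q ξ‖ * Real.exp (1 / √t) ≤ R :=
    (mul_le_mul_of_nonneg_right (norm_asepMap_le_of_re_nonneg hp hpq h1 h3)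
      (Real.exp_pos _).le).trans ht1
  have hmain := pow_le_div_asepWeight hq hB0 hR1.le ht2 hρ1 hρR k
  have hsup := asepEps_re_add_growth_le hp hpq hsum hB hgain h1 (by linarith : ‖ξ‖ - 1 ≤ R - 1)
  have hM := norm_asepMap_sub_one_le hp hpq hsum h1
  have hu : 0 ≤ ‖ξ‖ - ξ.re := sub_nonneg.2 (Complex.re_le_norm ξ)
  rw [← hd, ← hκ0] at hsup
  rw [← hC1] at hmain
  set s := √t
  set ρ := ‖asepMap p q ξ‖
  set r := ‖ξ‖
  set u := r - ξ.re
  have hlog0 : 0 ≤ Real.log r := Real.log_nonneg h1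
  have hlog1 : Real.log r ≤ r - 1 := Real.log_le_sub_one_of_pos (by linarith)
  have hw := asepWeight_pos (q := q) (t := t) hB0 hR1.le k
  have hexp : asepSite p q y t * Real.log r + t * (asepEps p q ξ).re +
      (t * growth q B (ρ - 1) + C1 * s * (ρ - 1) + 4 * q * B * R ^ 2) ≤
      4 * q * B * R ^ 2 + C3 ^ 2 / (4 * d) + t * growth q B (r - 1) + -(κ0 / 2 * t * u) := by
    have a1 := mul_le_mul_of_nonneg_left hsup (by linarith : 0 ≤ t)
    have a2 : (q - p) * y * s * Real.log r ≤ (q - p) * |y| * s * (r - 1) := by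
      have : 0 ≤ q - p := by linarith
      calc (q - p) * y * s * Real.log r ≤ (q - p) * |y| * s * Real.log r := by
            gcongr; exact le_abs_self y
        _ ≤ _ := by gcongr
    have a3 : C1 * s * (ρ - 1) ≤ C1 * s * (r - 1) + 2 * C1 * s * u := by
      have := mul_le_mul_of_nonneg_left hM (by positivity : 0 ≤ C1 * s)
      linarith
    have a4 : 2 * C1 * s * u ≤ κ0 / 2 * t * u := by
      refine mul_le_mul_of_nonneg_right ?_ hu
      rw [div_le_iff₀ hκ00] at hs3
      rw [← hs2]
      nlinarith
    have a5 : C3 * s * (r - 1) ≤ t * (d * (r - 1) ^ 2) + C3 ^ 2 / (4 * d) := by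
      have : t * (d * (r - 1) ^ 2) + C3 ^ 2 / (4 * d) - C3 * s * (r - 1) =
          d * (s * (r - 1) - C3 / (2 * d)) ^ 2 := by
        rw [← hs2]
        field_simp
        ring
      have h0 : 0 ≤ d * (s * (r - 1) - C3 / (2 * d)) ^ 2 := by positivity
      linarith
    have a6 : C3 * s * (r - 1) = (q - p) * |y| * s * (r - 1) + C1 * s * (r - 1) := by
      rw [hC3]; ring
    have a7 : asepSite p q y t * Real.log r =
        -(t * ((q - p) * Real.log r)) + (q - p) * y * s * Real.log r := by
      simp only [asepSite]; ring
    rw [a7]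
    linarith
  calc _ ≤ Real.exp (asepSite p q y t * Real.log r + t * (asepEps p q ξ).re) *
        (Real.exp (t * growth q B (ρ - 1) + C1 * s * (ρ - 1) + 4 * q * B * R ^ 2) *
          (Real.exp (-(k / s)) / asepWeight q B R t k)) := by gcongr
    _ = Real.exp (asepSite p q y t * Real.log r + t * (asepEps p q ξ).re +
        (t * growth q B (ρ - 1) + C1 * s * (ρ - 1) + 4 * q * B * R ^ 2)) *
          (Real.exp (-(k / s)) / asepWeight q B R t k) := by
        rw [Real.exp_add _ (t * growth q B (ρ - 1) + C1 * s * (ρ - 1) + 4 * q * B * R ^ 2)]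
        ring
    _ ≤ Real.exp (4 * q * B * R ^ 2 + C3 ^ 2 / (4 * d) + t * growth q B (r - 1) +
        -(κ0 / 2 * t * u)) * (Real.exp (-(k / s)) / asepWeight q B R t k) := by gcongr
    _ = _ := by
        rw [Real.exp_add _ (-(κ0 / 2 * t * u)), Real.exp_add _ (t * growth q B (r - 1))]
        ring

/-- Decay `e^(-(q-p)t)` against errors `e^(O(√t))`. The final alternative describes the discarded
contour pieces, segments of the imaginary axis and the left arc of `|ξ| = R`; on either of them
`|M|` stays below `R`. -/
theorem exists_bound_left {B : ℝ} (hB : 0 < B) :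
    ∀ᶠ t in atTop, ∀ (k : ℕ) (ξ : ℂ), 1 ≤ ‖ξ‖ → ‖ξ‖ ≤ R → ξ.re ≤ 0 →
      (0 ≤ ξ.re ∨ ‖ξ‖ = R) →
      Real.exp (asepSite p q y t * Real.log ‖ξ‖ + t * (asepEps p q ξ).re) * ‖asepMap p q ξ‖ ^ k ≤
        1 / t * (Real.exp (-(k / √t)) / asepWeight q B R t k) := by
  have hq : 0 < q := by linarith
  have hR1 := one_lt_radius hp hpq hsum hR hpR
  set C1 := 2 * q * B * R with hC1
  have hC10 : 0 < C1 := by positivity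
  set C2 := 4 * q * B * R ^ 2 with hC2
  have hC20 : 0 < C2 := by positivity
  -- Collects all exponents of order `√t`; the last `2` pays for `2 log √t`, which produces the
  -- factor `1/t`.
  set C3 := (q - p) * |y| * R + C1 * R + C2 + 2 with hC3
  have hlt : (R + p) / (q * R) < R := by
    rw [div_lt_iff₀ (by positivity)]
    linarith
  filter_upwards [eventually_mul_exp_le (sqrt_one_add_sq_div_lt hp hpq hR hpR),
    eventually_mul_exp_le hlt,
    eventually_ge_atTop 1, eventually_ge_atTop ((C3 / (q - p)) ^ 2)] with
    t ht0 ht1 ht2 ht3 k ξ h1 h2 h3 h4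
  have hqp : 0 < q - p := by linarith
  have hs : 1 ≤ √t := Real.one_le_sqrt.2 ht2
  have hs2 : √t ^ 2 = t := Real.sq_sqrt (by linarith)
  have hs3 : C3 / (q - p) ≤ √t := Real.le_sqrt_of_sq_le ht3
  have hρ1 := one_le_norm_asepMap hp hpq hsum h1
  have hρR : ‖asepMap p q ξ‖ * Real.exp (1 / √t) ≤ R := by
    rcases h4 with h4 | h4
    · exact (mul_le_mul_of_nonneg_right (norm_asepMap_le_of_re_nonneg hp hpq h1 h4)
        (Real.exp_pos _).le).trans ht0
    · exact (mul_le_mul_of_nonneg_right (norm_asepMap_le hp hq hR h4)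
        (Real.exp_pos _).le).trans ht1
  have hmain := pow_le_div_asepWeight hq hB hR1.le ht2 hρ1 hρR k
  have hsup := asepEps_re_add_growth_le_of_re_nonpos hp hpq hsum hB h1 h3
  have hρR' : ‖asepMap p q ξ‖ ≤ R :=
    (le_mul_of_one_le_right (by linarith) (Real.one_le_exp (by positivity))).trans hρR
  rw [← hC1, ← hC2] at hmain
  set s := √t
  set ρ := ‖asepMap p q ξ‖
  set r := ‖ξ‖
  have hlog0 : 0 ≤ Real.log r := Real.log_nonneg h1
  have hlog1 : Real.log r ≤ r - 1 := Real.log_le_sub_one_of_pos (by linarith)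
  have hw := asepWeight_pos (q := q) (t := t) hB hR1.le k
  have hexp : asepSite p q y t * Real.log r + t * (asepEps p q ξ).re +
      (t * growth q B (ρ - 1) + C1 * s * (ρ - 1) + C2) ≤ -(2 * Real.log s) := by
    have a1 := mul_le_mul_of_nonneg_left hsup (by linarith : 0 ≤ t)
    have a2 : (q - p) * y * s * Real.log r ≤ (q - p) * |y| * s * R := by
      calc (q - p) * y * s * Real.log r ≤ (q - p) * |y| * s * Real.log r := by
            gcongr; exact le_abs_self y
        _ ≤ _ := by gcongr; linarith
    have a3 : C1 * s * (ρ - 1) ≤ C1 * s * R := by gcongr; linarith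
    have a4 : C2 ≤ C2 * s := le_mul_of_one_le_right hC20.le hs
    have a5 : Real.log s ≤ s := (Real.log_le_sub_one_of_pos (by linarith)).trans (by linarith)
    have a6 : C3 * s ≤ (q - p) * t := by
      rw [div_le_iff₀ hqp] at hs3
      rw [← hs2]
      nlinarith
    have a7 : asepSite p q y t * Real.log r =
        -(t * ((q - p) * Real.log r)) + (q - p) * y * s * Real.log r := by
      simp only [asepSite]; ring
    have a8 : 0 ≤ t * ((q - p) * Real.log r) := by positivity
    have a9 : C3 * s = (q - p) * |y| * s * R + C1 * s * R + C2 * s + 2 * s := by rw [hC3]; ring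
    rw [a7]
    linarith
  calc _ ≤ Real.exp (asepSite p q y t * Real.log r + t * (asepEps p q ξ).re) *
        (Real.exp (t * growth q B (ρ - 1) + C1 * s * (ρ - 1) + C2) *
          (Real.exp (-(k / s)) / asepWeight q B R t k)) := by gcongr
    _ = Real.exp (asepSite p q y t * Real.log r + t * (asepEps p q ξ).re +
        (t * growth q B (ρ - 1) + C1 * s * (ρ - 1) + C2)) *
          (Real.exp (-(k / s)) / asepWeight q B R t k) := by
        rw [Real.exp_add _ (t * growth q B (ρ - 1) + C1 * s * (ρ - 1) + C2)]
        ring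
    _ ≤ Real.exp (-(2 * Real.log s)) * (Real.exp (-(k / s)) / asepWeight q B R t k) := by gcongr
    _ = _ := by
        rw [Real.exp_neg, mul_comm 2, Real.exp_mul, Real.exp_log (by linarith), one_div, ← hs2]
        norm_num

end Bounds

/-! ### Deformation of the contour -/

/-- In the logarithmic coordinate neither the branch cut of `ξ^x` nor the pole at `ξ = 0` is
present, so the contour can be moved freely. -/
theorem differentiable_asepIntegrand (p q x t : ℝ) (j k : ℕ) :
    Differentiable ℂ (asepIntegrand p q x t j k) := by
  intro w
  unfold asepIntegrand asepEps asepMap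
  -- For `q = 0` the Möbius map is identically `0` by the convention for division by zero.
  by_cases hq : (q : ℂ) = 0
  · simp only [hq, zero_mul, div_zero]
    have := Complex.exp_ne_zero w
    fun_prop (disch := assumption)
  · have h1 := Complex.exp_ne_zero w
    have h2 : (q : ℂ) * Complex.exp w ≠ 0 := mul_ne_zero hq h1
    fun_prop (disch := assumption)

theorem norm_asepIntegrand (p q x t : ℝ) (j k : ℕ) {ξ : ℂ} {a θ : ℝ}
    (hξ : ξ = Complex.exp (a + θ * Complex.I)) :
    ‖asepIntegrand p q x t j k (a + θ * Complex.I)‖ =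
      Real.exp (x * Real.log ‖ξ‖ + t * (asepEps p q ξ).re) * ‖asepMap p q ξ‖ ^ k *
        Real.exp (-((j + 1) * a)) := by
  have hn : Real.log ‖ξ‖ = a := by
    rw [hξ, Complex.norm_exp, Real.log_exp]
    simp
  unfold asepIntegrand
  rw [← hξ, hn, norm_mul, norm_mul, norm_pow, Complex.norm_exp, Complex.norm_exp]
  have e1 : ((a + θ * Complex.I) * ((x : ℂ) - ((j : ℂ) + 1))).re = x * a + -((j + 1) * a) := by
    simp
    ring
  have e2 : (asepEps p q ξ * t).re = t * (asepEps p q ξ).re := by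
    rw [Complex.re_mul_ofReal, mul_comm]
  rw [e1, e2, Real.exp_add, Real.exp_add]
  ring

/-- Moving the middle half of a vertical segment of integration. -/
theorem integral_vertical_eq {f : ℂ → ℂ} (hf : Differentiable ℂ f) (a b : ℝ) :
    ∫ θ in (-π)..π, f (b + θ * Complex.I) =
      (∫ θ in (-(π / 2))..(π / 2), f (a + θ * Complex.I)) +
      Complex.I * ((∫ x in a..b, f (x + (-(π / 2) : ℝ) * Complex.I)) -
        ∫ x in a..b, f (x + (π / 2 : ℝ) * Complex.I)) +
      ((∫ θ in (-π)..(-(π / 2)), f (b + θ * Complex.I)) +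
        ∫ θ in (π / 2)..π, f (b + θ * Complex.I)) := by
  have hc : Continuous fun θ : ℝ => f (b + θ * Complex.I) := by
    have := hf.continuous
    fun_prop
  -- In the `ξ` plane, the right half of `|ξ| = e^b` is replaced by the right half of `|ξ| = e^a`
  -- and two segments of the imaginary axis.
  have h := Complex.integral_boundary_rect_eq_zero_of_differentiableOn f
    (a + (-(π / 2) : ℝ) * Complex.I) (b + (π / 2 : ℝ) * Complex.I) hf.differentiableOn
  have r1 : ((a : ℂ) + (-(π / 2) : ℝ) * Complex.I).re = a := by simp
  have r2 : ((b : ℂ) + (π / 2 : ℝ) * Complex.I).re = b := by simp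
  have i1 : ((a : ℂ) + (-(π / 2) : ℝ) * Complex.I).im = -(π / 2) := by simp
  have i2 : ((b : ℂ) + (π / 2 : ℝ) * Complex.I).im = π / 2 := by simp
  rw [r1, r2, i1, i2] at h
  rw [← intervalIntegral.integral_add_adjacent_intervals (a := -π) (b := π / 2) (c := π)
    (hc.intervalIntegrable _ _) (hc.intervalIntegrable _ _),
    ← intervalIntegral.integral_add_adjacent_intervals (a := -π) (b := -(π / 2)) (c := π / 2)
    (hc.intervalIntegrable _ _) (hc.intervalIntegrable _ _)]
  simp only [smul_eq_mul] at h
  linear_combination (-Complex.I) * h + ((∫ θ in (-(π / 2))..(π / 2), f (b + θ * Complex.I)) -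
    ∫ θ in (-(π / 2))..(π / 2), f (a + θ * Complex.I)) * Complex.I_sq

/-- From `1 - cos θ ≥ 2θ²/π²`. With `κ` proportional to `t` this is the source of the factor `1/√t`
in the entries. -/
theorem integral_exp_neg_one_sub_cos_le {κ : ℝ} (hκ : 0 < κ) :
    ∫ θ in (-(π / 2))..(π / 2), Real.exp (-(κ * (1 - Real.cos θ))) ≤
      √(π / (κ * (2 / π ^ 2))) := by
  have hpi := Real.pi_pos
  have hb : 0 < κ * (2 / π ^ 2) := by positivity
  rw [← integral_gaussian, intervalIntegral.integral_of_le (by linarith)]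
  refine le_trans (setIntegral_mono_on ?_ (integrable_exp_neg_mul_sq hb).integrableOn
    measurableSet_Ioc fun θ hθ => ?_) (setIntegral_le_integral (integrable_exp_neg_mul_sq hb)
      (Eventually.of_forall fun _ => (Real.exp_pos _).le))
  · exact (Continuous.intervalIntegrable (by fun_prop) _ _).1
  · refine Real.exp_le_exp.2 ?_
    have := Real.cos_le_one_sub_mul_cos_sq (x := θ)
      (abs_le.2 ⟨by linarith [hθ.1], by linarith [hθ.2]⟩)
    have h2 := mul_le_mul_of_nonneg_left this hκ.le
    linarith

/-! ### Uniform estimates for the entries on the deformed contour -/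

section Bounds

variable {p q : ℝ} (hp : 0 ≤ p) (hpq : p < q) (hsum : p + q = 1) (y : ℝ) {R : ℝ} (hR : 0 < R)
  (hpR : R + p < q * R ^ 2)

include hp hpq hsum hR hpR

/-- Up to a negligible error, the entries are given by the right half of a smaller circle. -/
theorem exists_norm_asepEntry_sub_le {B : ℝ} (hB : 0 < B) :
    ∃ C > 0, ∀ᶠ t in atTop, ∀ j k : ℕ, ∀ r ∈ Set.Icc 1 R,
      ‖asepEntry p q (asepSite p q y t) t R j k - (2 * (π : ℂ) * q)⁻¹ *
        ∫ θ in (-(π / 2))..(π / 2),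
          asepIntegrand p q (asepSite p q y t) t j k (Real.log r + θ * Complex.I)‖ ≤
      C / t * (r ^ j)⁻¹ * (Real.exp (-(k / √t)) / asepWeight q B R t k) := by
  have hq : 0 < q := by linarith
  have hpi := Real.pi_pos
  have hR1 := one_lt_radius hp hpq hsum hR hpR
  have hlogR : 0 < Real.log R := Real.log_pos hR1
  refine ⟨(2 * π * q)⁻¹ * (2 * Real.log R + π), by positivity, ?_⟩
  filter_upwards [exists_bound_left hp hpq hsum y hR hpR hB, eventually_gt_atTop 0] with
    t ht ht0 j k r hr
  have hr0 : 0 < r := by linarith [hr.1]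
  set x := asepSite p q y t
  set F := asepIntegrand p q x t j k
  set S := 1 / t * (Real.exp (-(k / √t)) / asepWeight q B R t k) * (r ^ j)⁻¹ with hS
  -- One bound for all four discarded pieces: `cos θ = 0` on the two segments and `a = log R` on the
  -- two arcs. Since `|ξ| ≥ r` throughout, the factor `r^(-j)` survives.
  have hF : ∀ a θ : ℝ, Real.log r ≤ a → a ≤ Real.log R → Real.cos θ ≤ 0 →
      (0 ≤ Real.cos θ ∨ a = Real.log R) → ‖F (a + θ * Complex.I)‖ ≤ S := by
    intro a θ h1 h2 h3 h4
    set ξ := Complex.exp (a + θ * Complex.I) with hξ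
    have hn : ‖ξ‖ = Real.exp a := by rw [hξ, Complex.norm_exp]; simp
    have hre : ξ.re = Real.exp a * Real.cos θ := by rw [hξ, Complex.exp_re]; simp
    have ha0 : 0 ≤ a := (Real.log_nonneg hr.1).trans h1
    have hb := ht k ξ (by rw [hn]; exact Real.one_le_exp ha0)
      (by rw [hn, ← Real.exp_log hR]; exact Real.exp_le_exp.2 h2)
      (by rw [hre]; exact mul_nonpos_of_nonneg_of_nonpos (Real.exp_pos _).le h3)
      (by
        rcases h4 with h4 | h4
        · left; rw [hre]; exact mul_nonneg (Real.exp_pos _).le h4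
        · right; rw [hn, h4, Real.exp_log hR])
    rw [norm_asepIntegrand p q x t j k hξ, hS]
    have h5 : Real.exp (-((j + 1) * a)) ≤ (r ^ j)⁻¹ := by
      rw [show (r ^ j)⁻¹ = Real.exp (-(j * Real.log r)) by
        rw [Real.exp_neg, Real.exp_nat_mul, Real.exp_log hr0]]
      refine Real.exp_le_exp.2 (neg_le_neg ?_)
      calc (j : ℝ) * Real.log r ≤ j * a := by gcongr
        _ ≤ _ := by linarith
    exact mul_le_mul hb h5 (Real.exp_pos _).le (le_trans (by positivity) hb)
  have e : asepEntry p q x t R j k - (2 * (π : ℂ) * q)⁻¹ *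
      ∫ θ in (-(π / 2))..(π / 2), F (Real.log r + θ * Complex.I) =
      (2 * (π : ℂ) * q)⁻¹ * (Complex.I *
        ((∫ x in (Real.log r)..(Real.log R), F (x + (-(π / 2) : ℝ) * Complex.I)) -
          ∫ x in (Real.log r)..(Real.log R), F (x + (π / 2 : ℝ) * Complex.I)) +
      ((∫ θ in (-π)..(-(π / 2)), F (Real.log R + θ * Complex.I)) +
        ∫ θ in (π / 2)..π, F (Real.log R + θ * Complex.I))) := by
    rw [asepEntry, integral_vertical_eq (differentiable_asepIntegrand p q x t j k) (Real.log r)]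
    ring
  have hle : Real.log r ≤ Real.log R := Real.log_le_log hr0 hr.2
  have hlogr : 0 ≤ Real.log r := Real.log_nonneg hr.1
  have hnorm : ∀ z : ℂ, ‖(2 * (π : ℂ) * q)⁻¹ * z‖ = (2 * π * q)⁻¹ * ‖z‖ := by
    intro z
    rw [norm_mul, norm_inv, norm_mul, norm_mul]
    simp [abs_of_pos hpi, abs_of_pos hq]
  have hS0 : 0 ≤ S := (norm_nonneg _).trans (hF (Real.log R) (π / 2) hle le_rfl
    (by simp) (by simp))
  have b1 : ‖∫ x in (Real.log r)..(Real.log R), F (x + (-(π / 2) : ℝ) * Complex.I)‖ ≤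
      S * Real.log R := by
    refine (intervalIntegral.norm_integral_le_of_norm_le_const (C := S) fun a ha => ?_).trans ?_
    · rw [Set.uIoc_of_le hle] at ha
      exact hF a _ ha.1.le ha.2 (by simp) (by simp)
    · rw [abs_of_nonneg (by linarith)]
      gcongr
      linarith
  have b2 : ‖∫ x in (Real.log r)..(Real.log R), F (x + (π / 2 : ℝ) * Complex.I)‖ ≤
      S * Real.log R := by
    refine (intervalIntegral.norm_integral_le_of_norm_le_const (C := S) fun a ha => ?_).trans ?_
    · rw [Set.uIoc_of_le hle] at ha
      exact hF a _ ha.1.le ha.2 (by simp) (by simp)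
    · rw [abs_of_nonneg (by linarith)]
      gcongr
      linarith
  have b3 : ‖∫ θ in (-π)..(-(π / 2)), F (Real.log R + θ * Complex.I)‖ ≤ S * (π / 2) := by
    refine (intervalIntegral.norm_integral_le_of_norm_le_const (C := S) fun θ hθ => ?_).trans ?_
    · rw [Set.uIoc_of_le (by linarith)] at hθ
      refine hF _ θ hle le_rfl ?_ (Or.inr rfl)
      rw [← Real.cos_neg]
      exact Real.cos_nonpos_of_pi_div_two_le_of_le (by linarith [hθ.2]) (by linarith [hθ.1])
    · rw [abs_of_nonneg (by linarith)]
      exact le_of_eq (by ring)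
  have b4 : ‖∫ θ in (π / 2)..π, F (Real.log R + θ * Complex.I)‖ ≤ S * (π / 2) := by
    refine (intervalIntegral.norm_integral_le_of_norm_le_const (C := S) fun θ hθ => ?_).trans ?_
    · rw [Set.uIoc_of_le (by linarith)] at hθ
      refine hF _ θ hle le_rfl ?_ (Or.inr rfl)
      exact Real.cos_nonpos_of_pi_div_two_le_of_le (by linarith [hθ.1]) (by linarith [hθ.2])
    · rw [abs_of_nonneg (by linarith)]
      exact le_of_eq (by ring)
  rw [e, hnorm]
  have hfin : (2 * π * q)⁻¹ * (2 * Real.log R + π) / t * (r ^ j)⁻¹ *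
      (Real.exp (-(k / √t)) / asepWeight q B R t k) =
      (2 * π * q)⁻¹ * ((S * Real.log R + S * Real.log R) + (S * (π / 2) + S * (π / 2))) := by
    rw [hS]; ring
  rw [hfin]
  refine mul_le_mul_of_nonneg_left ?_ (by positivity)
  refine (norm_add_le _ _).trans (add_le_add ?_ ((norm_add_le _ _).trans (add_le_add b3 b4)))
  rw [norm_mul, Complex.norm_I, one_mul]
  exact (norm_sub_le _ _).trans (add_le_add b1 b2)

/-- For row `j` the contour has the radius `r` attaining the minimum in the weight, so `e^(tH(r-1))
r^(-j)` is exactly `ω_j`; the integral over the angle gives `1/√t`. -/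
theorem exists_norm_asepEntry_le {B : ℝ} (hB : 1 < B) (hBτ : 1 < B * (1 - p / q)) :
    ∃ C > 0, ∀ᶠ t in atTop, ∀ j k : ℕ,
      ‖asepEntry p q (asepSite p q y t) t R j k‖ ≤
        C / √t * Real.exp (-(k / √t)) * (asepWeight q B R t j / asepWeight q B R t k) := by
  have hq : 0 < q := by linarith
  have hpi := Real.pi_pos
  have hB0 : 0 < B := by linarith
  have hR1 := one_lt_radius hp hpq hsum hR hpR
  obtain ⟨C1, hC1, h1⟩ := exists_norm_asepEntry_sub_le hp hpq hsum y hR hpR hB0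
  obtain ⟨C2, hC2, κ, hκ, h2⟩ := exists_bound_right hp hpq hsum y hR hpR hB hBτ
  set D := √(π / (κ * (2 / π ^ 2))) with hD
  refine ⟨C1 + (2 * π * q)⁻¹ * (C2 * D), by positivity, ?_⟩
  filter_upwards [h1, h2, eventually_ge_atTop 1] with t h1 h2 ht1 j k
  have hs : 1 ≤ √t := Real.one_le_sqrt.2 ht1
  have ht0 : 0 < t := by linarith
  obtain ⟨r, hr, hrw⟩ := exists_asepWeight_eq (q := q) (t := t) hB0 hR1.le j
  have hr0 : 0 < r := by linarith [hr.1]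
  have hw := asepWeight_pos (q := q) (t := t) hB0 hR1.le k
  have h3 := h1 j k r hr
  set x := asepSite p q y t
  set F := asepIntegrand p q x t j k
  set E := Real.exp (-(k / √t)) / asepWeight q B R t k with hE
  have hE0 : 0 ≤ E := by positivity
  have hlogr : 0 ≤ Real.log r := Real.log_nonneg hr.1
  have hg : 0 ≤ growth q B (r - 1) := growth_nonneg hq.le hB0 (by linarith [hr.1])
  have hrj : (r ^ j)⁻¹ ≤ asepWeight q B R t j := by
    rw [hrw]
    exact le_mul_of_one_le_left (by positivity) (Real.one_le_exp (by positivity))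
  have hwj := asepWeight_pos (q := q) (t := t) hB0 hR1.le j
  have h4 : ‖∫ θ in (-(π / 2))..(π / 2), F (Real.log r + θ * Complex.I)‖ ≤
      C2 * asepWeight q B R t j * E * (D / √t) := by
    have hbd : ∀ θ ∈ Set.Ioc (-(π / 2)) (π / 2), ‖F (Real.log r + θ * Complex.I)‖ ≤
        C2 * asepWeight q B R t j * E * Real.exp (-(κ * t * (1 - Real.cos θ))) := by
      intro θ hθ
      set ξ := Complex.exp (Real.log r + θ * Complex.I) with hξ
      have hn : ‖ξ‖ = r := by rw [hξ, Complex.norm_exp]; simp [Real.exp_log hr0]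
      have hre : ξ.re = r * Real.cos θ := by
        rw [hξ, Complex.exp_re]; simp [Real.exp_log hr0]
      have hcos : 0 ≤ Real.cos θ := Real.cos_nonneg_of_mem_Icc ⟨hθ.1.le, hθ.2⟩
      have hb := h2 k ξ (by rw [hn]; exact hr.1) (by rw [hn]; exact hr.2)
        (by rw [hre]; positivity)
      rw [norm_asepIntegrand p q x t j k hξ]
      have h5 : Real.exp (-((j + 1) * Real.log r)) ≤ (r ^ j)⁻¹ := by
        rw [show (r ^ j)⁻¹ = Real.exp (-(j * Real.log r)) by
        rw [Real.exp_neg, Real.exp_nat_mul, Real.exp_log hr0]]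
        refine Real.exp_le_exp.2 (neg_le_neg ?_)
        linarith
      refine (mul_le_mul hb h5 (Real.exp_pos _).le (le_trans (by positivity) hb)).trans ?_
      rw [hn, hre, hrw]
      have h6 : Real.exp (-(κ * t * (r - r * Real.cos θ))) ≤
          Real.exp (-(κ * t * (1 - Real.cos θ))) := by
        refine Real.exp_le_exp.2 (neg_le_neg (mul_le_mul_of_nonneg_left ?_ (by positivity)))
        have := Real.cos_le_one θ
        nlinarith [hr.1]
      calc _ = C2 * (Real.exp (t * growth q B (r - 1)) * (r ^ j)⁻¹) * E *
            Real.exp (-(κ * t * (r - r * Real.cos θ))) := by rw [hE]; ring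
        _ ≤ _ := by gcongr
    refine (intervalIntegral.norm_integral_le_of_norm_le (by linarith)
      (Eventually.of_forall fun θ hθ => hbd θ hθ)
      (Continuous.intervalIntegrable (by fun_prop) _ _)).trans ?_
    rw [intervalIntegral.integral_const_mul]
    refine mul_le_mul_of_nonneg_left ?_ (by positivity)
    refine (integral_exp_neg_one_sub_cos_le (by positivity)).trans
      (le_of_eq ?_)
    rw [hD, ← Real.sqrt_div (by positivity)]
    congr 1
    field_simp
  have hnorm : ∀ z : ℂ, ‖(2 * (π : ℂ) * q)⁻¹ * z‖ = (2 * π * q)⁻¹ * ‖z‖ := by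
    intro z
    rw [norm_mul, norm_inv, norm_mul, norm_mul]
    simp [abs_of_pos hpi, abs_of_pos hq]
  have h5 := norm_le_norm_add_norm_sub' (asepEntry p q x t R j k) ((2 * (π : ℂ) * q)⁻¹ *
        ∫ θ in (-(π / 2))..(π / 2), F (Real.log r + θ * Complex.I))
  rw [hnorm] at h5
  refine h5.trans ((add_le_add (mul_le_mul_of_nonneg_left h4 (by positivity)) h3).trans ?_)
  have h6 : C1 / t * (r ^ j)⁻¹ * E ≤ C1 / √t * asepWeight q B R t j * E := by
    gcongr
    rw [Real.sqrt_le_left (by linarith)]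
    nlinarith
  refine (add_le_add_right h6 _).trans (le_of_eq ?_)
  rw [hE]
  ring

end Bounds

/-! ### Pointwise limit of the rescaled entries -/

theorem tendsto_sqrt_mul_comp_div {g : ℝ → ℂ} {g' : ℂ} (hg : HasDerivAt g g' 0) (h0 : g 0 = 0)
    (v : ℝ) : Tendsto (fun t : ℝ => (√t : ℂ) * g (v / √t)) atTop (𝓝 (v * g')) := by
  have h1 : HasDerivAt (fun u : ℝ => g (v * u)) (v * g') 0 := by
    have h2 : HasDerivAt (fun u : ℝ => v * u) v 0 := by
      simpa using (hasDerivAt_id (0 : ℝ)).const_mul v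
    have h3 : HasDerivAt g g' (v * 0) := by simpa using hg
    have := h3.scomp (0 : ℝ) h2
    simpa [Function.comp_def] using this
  have h2 := h1.tendsto_slope_zero
  have h3 : Tendsto (fun t : ℝ => (√t)⁻¹) atTop (𝓝[≠] 0) := by
    refine tendsto_nhdsWithin_iff.2 ⟨tendsto_inv_atTop_zero.comp Real.tendsto_sqrt_atTop, ?_⟩
    filter_upwards [eventually_gt_atTop 0] with t ht
    exact (inv_pos.2 (Real.sqrt_pos.2 ht)).ne'
  refine (h2.comp h3).congr fun t => ?_
  simp [h0, div_eq_mul_inv]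

theorem tendsto_mul_cos_sub_one (v : ℝ) :
    Tendsto (fun t : ℝ => t * (Real.cos (v / √t) - 1)) atTop (𝓝 (-(v ^ 2 / 2))) := by
  have h1 : HasDerivAt (fun θ : ℝ => ((Real.sin θ : ℝ) : ℂ)) 1 0 := by
    have := (Real.hasDerivAt_sin 0).ofReal_comp
    simpa using this
  have h2 := tendsto_sqrt_mul_comp_div h1 (by simp) (v / 2)
  have h3 := (Complex.continuous_re.tendsto _).comp h2
  have h4 := (h3.pow 2).const_mul (-2)
  refine (h4.congr' ?_).trans (le_of_eq ?_)
  · filter_upwards [eventually_ge_atTop 0] with t ht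
    simp only [Function.comp, ← Complex.ofReal_mul, Complex.ofReal_re]
    rw [mul_pow, Real.sq_sqrt ht, Real.sin_sq_eq_half_sub]
    rw [show 2 * (v / 2 / √t) = v / √t by ring]
    ring
  · congr 1
    simp
    ring

/-- The error is of order `tθ³ = O(1/√t)`. This is what remains when the drift `(p-q)t` of the site
meets the term `(q-p) t sin θ` of the exponent. -/
theorem tendsto_mul_sin_sub (v : ℝ) :
    Tendsto (fun t : ℝ => t * (Real.sin (v / √t) - v / √t)) atTop (𝓝 0) := by
  have h1 : Tendsto (fun t : ℝ => |v| ^ 3 * (√t)⁻¹) atTop (𝓝 0) := by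
    simpa using (tendsto_inv_atTop_zero.comp Real.tendsto_sqrt_atTop).const_mul (|v| ^ 3)
  refine squeeze_zero_norm' ?_ h1
  filter_upwards [eventually_gt_atTop 0, eventually_ge_atTop (v ^ 2)] with t ht0 ht1
  have hs : 0 < √t := Real.sqrt_pos.2 ht0
  have hs2 : √t ^ 2 = t := Real.sq_sqrt ht0.le
  have h2 : |v / √t| ≤ 1 := by
    rw [abs_div, abs_of_pos hs, div_le_one hs]
    exact Real.abs_le_sqrt ht1
  have h3 := Real.sin_bound h2
  set θ := v / √t with hθ
  have h4 : |Real.sin θ - θ| ≤ |θ| ^ 3 := by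
    have e : Real.sin θ - θ = (Real.sin θ - (θ - θ ^ 3 / 6)) + (-(θ ^ 3 / 6)) := by ring
    rw [e]
    refine (abs_add_le _ _).trans ?_
    rw [abs_neg, abs_div, abs_pow, abs_of_pos (by norm_num : (0 : ℝ) < 6)]
    have h5 : |θ| ^ 5 ≤ |θ| ^ 3 := pow_le_pow_of_le_one (abs_nonneg _) h2 (by norm_num)
    have h6 : 0 ≤ |θ| ^ 3 := by positivity
    linarith
  rw [Real.norm_eq_abs, abs_mul, abs_of_pos ht0]
  calc t * |Real.sin θ - θ| ≤ t * |θ| ^ 3 := by gcongr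
    _ = _ := by
      rw [hθ, abs_div, abs_of_pos hs, ← hs2, Real.sqrt_sq hs.le]
      field_simp

theorem tendsto_floor_sqrt_mul_div {s : ℝ} (hs : 0 ≤ s) :
    Tendsto (fun t : ℝ => (⌊√t * s⌋₊ : ℝ) / √t) atTop (𝓝 s) := by
  have h := (tendsto_nat_floor_mul_div_atTop hs).comp Real.tendsto_sqrt_atTop
  refine h.congr fun t => ?_
  simp only [Function.comp, mul_comm]

section Limit

variable {p q : ℝ} (hp : 0 ≤ p) (hpq : p < q) (hsum : p + q = 1) (y : ℝ)

include hsum in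
theorem asepEps_exp_mul_I (θ : ℝ) : asepEps p q (Complex.exp (θ * Complex.I)) =
    ((Real.cos θ - 1 : ℝ) : ℂ) + ((q - p) * Real.sin θ : ℝ) * Complex.I := by
  have hs : (p : ℂ) + q = 1 := by exact_mod_cast hsum
  unfold asepEps
  rw [← Complex.exp_neg, ← neg_mul, Complex.exp_mul_I, Complex.exp_mul_I, Complex.cos_neg,
    Complex.sin_neg]
  push_cast
  linear_combination Complex.cos θ * hs

include hpq hp hsum in
-- `M` fixes `1` with derivative `p/q`, so `log M(e^(iθ)) = i(p/q)θ + o(θ)`, multiplied by an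
-- exponent asymptotic to `√t s`.
theorem tendsto_asepMap_pow (v : ℝ) {s : ℝ} (hs : 0 ≤ s) :
    Tendsto (fun t : ℝ => asepMap p q (Complex.exp ((v / √t : ℝ) * Complex.I)) ^ ⌊√t * s⌋₊) atTop
      (𝓝 (Complex.exp (s * (v * (p / q * Complex.I))))) := by
  have hq : 0 < q := by linarith
  have hq0 : (q : ℂ) ≠ 0 := by exact_mod_cast hq.ne'
  have hs1 : (p : ℂ) + q = 1 := by exact_mod_cast hsum
  set g : ℝ → ℂ := fun θ => Complex.log (asepMap p q (Complex.exp (θ * Complex.I))) with hg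
  have hM1 : asepMap p q 1 = 1 := by
    unfold asepMap
    rw [mul_one, div_eq_one_iff_eq hq0]
    linear_combination -hs1
  have hg0 : g 0 = 0 := by simp [hg, hM1]
  have hd : HasDerivAt g (p / q * Complex.I) 0 := by
    have d1 : HasDerivAt (fun θ : ℝ => Complex.exp (-(θ * Complex.I))) (-Complex.I) 0 := by
      have : HasDerivAt (fun θ : ℝ => -((θ : ℂ) * Complex.I)) (-Complex.I) 0 := by
        simpa using (hasDerivAt_id (0 : ℝ)).ofReal_comp.mul_const (-Complex.I)
      simpa using this.cexp
    have d2 : HasDerivAt (fun θ : ℝ => (1 - p * Complex.exp (-(θ * Complex.I))) / (q : ℂ))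
        (p / q * Complex.I) 0 := by
      exact (((d1.const_mul (p : ℂ)).const_sub 1).div_const (q : ℂ)).congr_deriv (by ring)
    have e : g = fun θ : ℝ => Complex.log
        ((1 - p * Complex.exp (-(θ * Complex.I))) / (q : ℂ)) := by
      funext θ
      simp only [hg]
      rw [asepMap_eq hq.ne' (Complex.exp_ne_zero _), Complex.exp_neg]
    rw [e]
    have e1 : (1 - (p : ℂ) * Complex.exp (-(((0 : ℝ) : ℂ) * Complex.I))) / (q : ℂ) = 1 := by
      rw [div_eq_one_iff_eq hq0]
      simp
      linear_combination -hs1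
    have := d2.clog_real (by rw [e1]; simp)
    rwa [e1, div_one] at this
  have h1 := tendsto_sqrt_mul_comp_div hd hg0 v
  have h2 : Tendsto (fun t : ℝ => (((⌊√t * s⌋₊ : ℝ) / √t : ℝ) : ℂ)) atTop (𝓝 (s : ℂ)) :=
    (Complex.continuous_ofReal.tendsto s).comp (tendsto_floor_sqrt_mul_div hs)
  have h3 := (Complex.continuous_exp.tendsto _).comp (h2.mul h1)
  refine h3.congr' ?_
  filter_upwards [eventually_gt_atTop 0] with t ht
  have hs0 : (√t : ℂ) ≠ 0 := by exact_mod_cast (Real.sqrt_pos.2 ht).ne'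
  have hM : asepMap p q (Complex.exp ((v / √t : ℝ) * Complex.I)) ≠ 0 := by
    have := one_le_norm_asepMap hp hpq hsum
      (ξ := Complex.exp ((v / √t : ℝ) * Complex.I)) (by rw [Complex.norm_exp_ofReal_mul_I])
    exact norm_pos_iff.1 (by linarith)
  simp only [Function.comp, hg]
  rw [← mul_assoc]
  have e : (((⌊√t * s⌋₊ : ℝ) / √t : ℝ) : ℂ) * (√t : ℂ) = (⌊√t * s⌋₊ : ℂ) := by
    push_cast
    field_simp
  rw [e, Complex.exp_nat_mul, Complex.exp_log hM]

include hp hpq hsum in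
theorem tendsto_asepIntegrand (v : ℝ) {s s' : ℝ} (hs : 0 ≤ s) (hs' : 0 ≤ s') :
    Tendsto (fun t : ℝ => asepIntegrand p q (asepSite p q y t) t ⌊√t * s⌋₊ ⌊√t * s'⌋₊
      ((v / √t : ℝ) * Complex.I)) atTop
      (𝓝 (Complex.exp (Complex.I * ((p / q * s' + (q - p) * y - s : ℝ) : ℂ) * v) *
        Complex.exp (-(1 / 2 : ℂ) * v ^ 2))) := by
  have h1 := tendsto_asepMap_pow hp hpq hsum v hs'
  -- The last term `v/√t` comes from the `1` in the exponent `x - (j + 1)` and disappears in the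
  -- limit.
  have h2 : Tendsto (fun t : ℝ => ((t * (Real.cos (v / √t) - 1) : ℝ) : ℂ) +
      (((q - p) * (t * (Real.sin (v / √t) - v / √t)) + (q - p) * y * v -
        v * ((⌊√t * s⌋₊ : ℝ) / √t) - v * (√t)⁻¹ : ℝ) : ℂ) * Complex.I) atTop
      (𝓝 (((-(v ^ 2 / 2) : ℝ) : ℂ) +
        (((q - p) * 0 + (q - p) * y * v - v * s - v * 0 : ℝ) : ℂ) * Complex.I)) := by
    refine Tendsto.add ((Complex.continuous_ofReal.tendsto _).comp (tendsto_mul_cos_sub_one v))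
      (Tendsto.mul_const _ ((Complex.continuous_ofReal.tendsto _).comp ?_))
    refine Tendsto.sub (Tendsto.sub (((tendsto_mul_sin_sub v).const_mul _).add tendsto_const_nhds)
      ((tendsto_floor_sqrt_mul_div hs).const_mul v)) (Tendsto.const_mul v ?_)
    exact tendsto_inv_atTop_zero.comp Real.tendsto_sqrt_atTop
  have h3 := ((Complex.continuous_exp.tendsto _).comp h2).mul h1
  refine (h3.congr' ?_).trans (le_of_eq ?_)
  · filter_upwards [eventually_gt_atTop 0] with t ht
    have hs0 : 0 < √t := Real.sqrt_pos.2 ht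
    simp only [Function.comp, asepIntegrand]
    rw [← Complex.exp_add, asepEps_exp_mul_I hsum]
    congr 2
    have e : (q - p) * (t * (Real.sin (v / √t) - v / √t)) + (q - p) * y * v -
        v * ((⌊√t * s⌋₊ : ℝ) / √t) - v * (√t)⁻¹ =
        v / √t * (asepSite p q y t - ((⌊√t * s⌋₊ : ℝ) + 1)) + (q - p) * Real.sin (v / √t) * t := by
      have hs2 : t = √t ^ 2 := (Real.sq_sqrt ht.le).symm
      have : (asepSite p q y t) = (p - q) * √t ^ 2 + (q - p) * y * √t := by
        rw [← hs2, asepSite]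
      rw [this]
      field_simp
      linear_combination (-(q - p) * v) * hs2
    rw [e]
    push_cast
    ring
  · congr 1
    rw [← Complex.exp_add, ← Complex.exp_add]
    congr 1
    push_cast
    ring

include hp hpq hsum in
theorem norm_asepIntegrand_le {x t s' v : ℝ} {j : ℕ} (ht : 0 < t) (hs' : 0 ≤ s')
    (hts : 4 * s' ≤ √t) (hv : |v| ≤ √t * (π / 2)) :
    ‖asepIntegrand p q x t j ⌊√t * s'⌋₊ ((v / √t : ℝ) * Complex.I)‖ ≤
      Real.exp (-(1 / π ^ 2) * v ^ 2) := by
  have hq : 0 < q := by linarith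
  have hpi := Real.pi_pos
  have hs0 : 0 < √t := Real.sqrt_pos.2 ht
  have hs2 : √t ^ 2 = t := Real.sq_sqrt ht.le
  set θ := v / √t with hθ
  set k := ⌊√t * s'⌋₊
  have hk : (k : ℝ) ≤ √t * s' := Nat.floor_le (by positivity)
  have h1 := norm_asepIntegrand p q x t j k (ξ := Complex.exp (θ * Complex.I)) (a := 0) (θ := θ)
    (by simp)
  have hn : ‖Complex.exp (θ * Complex.I)‖ = 1 := Complex.norm_exp_ofReal_mul_I θ
  have hre : (Complex.exp (θ * Complex.I)).re = Real.cos θ := Complex.exp_ofReal_mul_I_re θ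
  have heps : (asepEps p q (Complex.exp (θ * Complex.I))).re = Real.cos θ - 1 := by
    rw [asepEps_exp_mul_I hsum]
    simp only [Complex.add_re, Complex.ofReal_re, Complex.re_ofReal_mul, Complex.I_re, mul_zero,
      add_zero]
  rw [Complex.ofReal_zero, zero_add, hn, heps] at h1
  rw [h1]
  have h2 := norm_asepMap_sub_one_le hp hpq hsum hn.ge
  rw [hn, hre] at h2
  have hcos : 0 ≤ 1 - Real.cos θ := by linarith [Real.cos_le_one θ]
  have h3 : ‖asepMap p q (Complex.exp (θ * Complex.I))‖ ^ k ≤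
      Real.exp (k * (2 * (1 - Real.cos θ))) := by
    rw [Real.exp_nat_mul]
    refine pow_le_pow_left₀ (norm_nonneg _) ?_ k
    have := Real.add_one_le_exp (2 * (1 - Real.cos θ))
    linarith
  have hθ1 : |θ| ≤ π := by
    rw [hθ, abs_div, abs_of_pos hs0, div_le_iff₀ hs0]
    nlinarith
  have h4 := Real.cos_le_one_sub_mul_cos_sq hθ1
  simp only [Real.log_one, mul_zero, zero_add, neg_zero, Real.exp_zero, mul_one]
  calc Real.exp (t * (Real.cos θ - 1)) * ‖asepMap p q (Complex.exp (θ * Complex.I))‖ ^ k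
      ≤ Real.exp (t * (Real.cos θ - 1)) * Real.exp (k * (2 * (1 - Real.cos θ))) := by gcongr
    _ = Real.exp (-((t - 2 * k) * (1 - Real.cos θ))) := by rw [← Real.exp_add]; ring_nf
    _ ≤ Real.exp (-(1 / π ^ 2) * v ^ 2) := by
        refine Real.exp_le_exp.2 ?_
        -- The condition `4s' ≤ √t` gives `2k ≤ t/2`, so half of the Gaussian decay is left.
        have a1 : t / 2 ≤ t - 2 * k := by nlinarith
        have a2 : t / 2 * (2 / π ^ 2 * θ ^ 2) ≤ (t - 2 * k) * (1 - Real.cos θ) :=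
          mul_le_mul a1 (by linarith) (by positivity) (by linarith)
        have a3 : t / 2 * (2 / π ^ 2 * θ ^ 2) = 1 / π ^ 2 * v ^ 2 := by
          rw [hθ, ← hs2, Real.sqrt_sq hs0.le]
          field_simp
        linarith

include hp hpq hsum in
-- Substitute `θ = v/√t`, pass to the limit by dominated convergence, and evaluate the Fourier
-- transform of a Gaussian.
theorem tendsto_sqrt_mul_integral {s s' : ℝ} (hs : 0 ≤ s) (hs' : 0 ≤ s') :
    Tendsto (fun t : ℝ => (√t : ℂ) * ∫ θ in (-(π / 2))..(π / 2),
      asepIntegrand p q (asepSite p q y t) t ⌊√t * s⌋₊ ⌊√t * s'⌋₊ (θ * Complex.I)) atTop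
      (𝓝 ((√(2 * π) * Real.exp (-(s - p / q * s' - (q - p) * y) ^ 2 / 2) : ℝ) : ℂ)) := by
  have hpi := Real.pi_pos
  set b : ℝ := p / q * s' + (q - p) * y - s with hb
  set G : ℝ → ℝ → ℂ := fun t v => (Set.Ioc (-(√t * (π / 2))) (√t * (π / 2))).indicator
    (fun v => asepIntegrand p q (asepSite p q y t) t ⌊√t * s⌋₊ ⌊√t * s'⌋₊
      ((v / √t : ℝ) * Complex.I)) v with hG
  have hcont : ∀ (t : ℝ) (j k : ℕ), Continuous fun v : ℝ =>
      asepIntegrand p q (asepSite p q y t) t j k ((v / √t : ℝ) * Complex.I) := by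
    intro t j k
    exact (differentiable_asepIntegrand p q _ t j k).continuous.comp (by fun_prop)
  have hlim : Tendsto (fun t => ∫ v, G t v) atTop (𝓝 (∫ v : ℝ,
      Complex.exp (Complex.I * (b : ℂ) * v) * Complex.exp (-(1 / 2 : ℂ) * v ^ 2))) := by
    refine tendsto_integral_filter_of_dominated_convergence
      (fun v => Real.exp (-(1 / π ^ 2) * v ^ 2)) ?_ ?_
      (integrable_exp_neg_mul_sq (by positivity)) ?_
    · exact Eventually.of_forall fun t =>
        (hcont t _ _).aestronglyMeasurable.indicator measurableSet_Ioc
    · filter_upwards [eventually_gt_atTop 0,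
        Real.tendsto_sqrt_atTop.eventually_ge_atTop (4 * s')] with t ht hts
      refine Eventually.of_forall fun v => ?_
      simp only [hG, Set.indicator]
      split_ifs with hv
      · exact norm_asepIntegrand_le hp hpq hsum ht hs' hts (abs_le.2 ⟨hv.1.le, hv.2⟩)
      · rw [norm_zero]; positivity
    · refine Eventually.of_forall fun v => ?_
      refine (tendsto_asepIntegrand hp hpq hsum y v hs hs').congr' ?_
      filter_upwards [Real.tendsto_sqrt_atTop.eventually_gt_atTop (|v| / (π / 2))] with t ht
      rw [div_lt_iff₀ (by positivity)] at ht
      simp only [hG]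
      rw [Set.indicator_of_mem]
      exact ⟨(abs_lt.1 ht).1, (abs_lt.1 ht).2.le⟩
  refine (hlim.congr' ?_).trans (le_of_eq ?_)
  · filter_upwards [eventually_gt_atTop 0] with t ht
    have hs0 : 0 < √t := Real.sqrt_pos.2 ht
    simp only [hG]
    rw [integral_indicator measurableSet_Ioc,
      ← intervalIntegral.integral_of_le (by nlinarith)]
    have := intervalIntegral.integral_comp_div (a := -(√t * (π / 2))) (b := √t * (π / 2))
      (fun θ : ℝ => asepIntegrand p q (asepSite p q y t) t ⌊√t * s⌋₊ ⌊√t * s'⌋₊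
        ((θ : ℂ) * Complex.I)) hs0.ne'
    rw [this, neg_div, mul_div_cancel_left₀ _ hs0.ne', Complex.real_smul]
  · congr 1
    have := fourierIntegral_gaussian (b := 1 / 2) (by norm_num) (b : ℂ)
    rw [this]
    have e1 : ((π : ℂ) / (1 / 2)) ^ (1 / 2 : ℂ) = ((√(2 * π) : ℝ) : ℂ) := by
      rw [Real.sqrt_eq_rpow, Complex.ofReal_cpow (by positivity)]
      push_cast
      congr 1
      ring
    rw [e1, Complex.ofReal_mul, Complex.ofReal_exp]
    congr 2
    rw [hb]
    push_cast
    ring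

variable {R : ℝ} (hR : 0 < R) (hpR : R + p < q * R ^ 2)

include hp hpq hsum hR hpR in
theorem tendsto_asepEntry {s s' : ℝ} (hs : 0 ≤ s) (hs' : 0 ≤ s') :
    Tendsto (fun t : ℝ => ((q * √t : ℝ) : ℂ) *
      asepEntry p q (asepSite p q y t) t R ⌊√t * s⌋₊ ⌊√t * s'⌋₊) atTop
      (𝓝 (((√(2 * π))⁻¹ * Real.exp (-(s - p / q * s' - (q - p) * y) ^ 2 / 2) : ℝ) : ℂ)) := by
  have hq : 0 < q := by linarith
  have hpi := Real.pi_pos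
  have hR1 := one_lt_radius hp hpq hsum hR hpR
  -- Here the weight only enters an error term, for which any positive `B` serves. The radius below
  -- is `r = 1`, through the critical point.
  obtain ⟨C, hC, h1⟩ := exists_norm_asepEntry_sub_le hp hpq hsum y hR hpR one_pos
  obtain ⟨c, hc, h2⟩ := exists_le_asepWeight hq one_pos hR1.le s'
  have hmain := (tendsto_sqrt_mul_integral hp hpq hsum y hs hs').const_mul (2 * (π : ℂ))⁻¹
  have herr : Tendsto (fun t : ℝ => ((q * √t : ℝ) : ℂ) *
      (asepEntry p q (asepSite p q y t) t R ⌊√t * s⌋₊ ⌊√t * s'⌋₊ - (2 * (π : ℂ) * q)⁻¹ *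
        ∫ θ in (-(π / 2))..(π / 2),
          asepIntegrand p q (asepSite p q y t) t ⌊√t * s⌋₊ ⌊√t * s'⌋₊ (θ * Complex.I))) atTop
      (𝓝 0) := by
    have hz : Tendsto (fun t : ℝ => q * C / c * (√t)⁻¹) atTop (𝓝 0) := by
      simpa using (tendsto_inv_atTop_zero.comp Real.tendsto_sqrt_atTop).const_mul (q * C / c)
    refine squeeze_zero_norm' ?_ hz
    filter_upwards [h1, eventually_gt_atTop 0] with t h1 ht
    have hs0 : 0 < √t := Real.sqrt_pos.2 ht
    have hs2 : √t ^ 2 = t := Real.sq_sqrt ht.le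
    have h3 := h1 ⌊√t * s⌋₊ ⌊√t * s'⌋₊ 1 (Set.left_mem_Icc.2 hR1.le)
    simp only [Real.log_one, Complex.ofReal_zero, zero_add, one_pow, inv_one, mul_one] at h3
    have h4 := h2 t ht ⌊√t * s'⌋₊ (by
      rw [mul_comm s']
      exact Nat.floor_le (by positivity))
    rw [norm_mul, Complex.norm_real, Real.norm_eq_abs, abs_of_pos (by positivity)]
    refine (mul_le_mul_of_nonneg_left h3 (by positivity)).trans ?_
    have h5 : Real.exp (-((⌊√t * s'⌋₊ : ℝ) / √t)) ≤ 1 :=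
      Real.exp_le_one_iff.2 (neg_nonpos.2 (by positivity))
    calc q * √t * (C / t * (Real.exp (-((⌊√t * s'⌋₊ : ℝ) / √t)) /
          asepWeight q 1 R t ⌊√t * s'⌋₊)) ≤ q * √t * (C / t * (1 / c)) := by gcongr
      _ = _ := by
          rw [← hs2, Real.sqrt_sq hs0.le]
          field_simp
  have hq0 : (q : ℂ) ≠ 0 := by exact_mod_cast hq.ne'
  have hpi0 : (π : ℂ) ≠ 0 := by exact_mod_cast hpi.ne'
  refine ((hmain.add herr).congr fun t => ?_).trans (le_of_eq ?_)
  · generalize (∫ θ in (-(π / 2))..(π / 2),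
      asepIntegrand p q (asepSite p q y t) t ⌊√t * s⌋₊ ⌊√t * s'⌋₊ (θ * Complex.I)) = J
    push_cast
    field_simp
    ring
  · congr 1
    rw [add_zero]
    have e : (2 * π) = √(2 * π) * √(2 * π) := (Real.mul_self_sqrt (by positivity)).symm
    have hs0 : √(2 * π) ≠ 0 := (Real.sqrt_pos.2 (by positivity)).ne'
    have e2 : (2 * (π : ℂ))⁻¹ = (((√(2 * π) * √(2 * π))⁻¹ : ℝ) : ℂ) := by
      rw [← e]; push_cast; ring
    rw [e2, ← Complex.ofReal_mul]
    congr 1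
    field_simp

end Limit

/-! ### Iterated kernels and Riemann sums -/

/-- The iterated kernels of `k`: `kernelIter μ k m` is the kernel of the `(m + 1)`-st power. -/
noncomputable def kernelIter {α : Type*} [MeasurableSpace α] (μ : Measure α) (k : α → α → ℂ) :
    ℕ → α → α → ℂ
  | 0 => k
  | m + 1 => fun x z => ∫ y, k x y * kernelIter μ k m y z ∂μ

theorem floor_mul_eq_iff_mem_Ico {c : ℝ} (hc : 0 < c) {u : ℝ} (hu : 0 ≤ u) (l : ℕ) :
    ⌊c * u⌋₊ = l ↔ u ∈ Set.Ico ((l : ℝ) / c) ((l + 1) / c) := by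
  rw [Nat.floor_eq_iff (by positivity), Set.mem_Ico, div_le_iff₀ hc, lt_div_iff₀ hc, mul_comm u]

/-- A series is the integral of a step function whose cells have length `1/c`. -/
theorem tsum_eq_integral_floor {c : ℝ} (hc : 0 < c) {h : ℕ → ℂ} (hh : Summable h) :
    ∑' l, h l = ∫ u in Set.Ioi (0 : ℝ), c * h ⌊c * u⌋₊ := by
  set S : ℕ → Set ℝ := fun l => Set.Ico ((l : ℝ) / c) ((l + 1) / c) with hS
  have hmem : ∀ l, ∀ u ∈ S l, ⌊c * u⌋₊ = l := fun l u hu =>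
    (floor_mul_eq_iff_mem_Ico hc (le_trans (by positivity) hu.1) l).2 hu
  have hSm : ∀ l, MeasurableSet (S l) := fun l => measurableSet_Ico
  have hSU : ⋃ l, S l = Set.Ici 0 := by
    ext u
    rw [Set.mem_iUnion, Set.mem_Ici]
    constructor
    · rintro ⟨l, hl⟩
      exact le_trans (by positivity) hl.1
    · intro hu
      exact ⟨_, (floor_mul_eq_iff_mem_Ico hc hu _).1 rfl⟩
  have hSd : Pairwise (Function.onFun Disjoint S) := by
    intro i j hij
    refine Set.disjoint_left.2 fun u h1 h2 => hij ?_
    rw [← hmem i u h1, hmem j u h2]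
  have hvol : ∀ l, volume.real (S l) = c⁻¹ := by
    intro l
    rw [Real.volume_real_Ico_of_le (by gcongr; linarith)]
    field_simp
    ring
  have hint : ∀ (l : ℕ), ∫ u in S l, (c : ℂ) * h ⌊c * u⌋₊ = h l := by
    intro l
    rw [setIntegral_congr_fun (g := fun _ => (c : ℂ) * h l) (hSm l)
      (fun u hu => by simp only [hmem l u hu]), setIntegral_const, hvol]
    have : (c : ℂ) ≠ 0 := by exact_mod_cast hc.ne'
    rw [Complex.real_smul]
    push_cast
    field_simp
  have hnorm : ∀ (l : ℕ), ∫ u in S l, ‖(c : ℂ) * h ⌊c * u⌋₊‖ = ‖h l‖ := by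
    intro l
    rw [setIntegral_congr_fun (g := fun _ => ‖(c : ℂ) * h l‖) (hSm l)
      (fun u hu => by simp only [hmem l u hu]), setIntegral_const, hvol, norm_mul,
      Complex.norm_real, Real.norm_eq_abs, abs_of_pos hc, smul_eq_mul]
    field_simp
  have hion : ∀ l, IntegrableOn (fun u : ℝ => (c : ℂ) * h ⌊c * u⌋₊) (S l) := by
    intro l
    refine (integrableOn_const (C := (c : ℂ) * h l) ?_).congr_fun
      (fun u hu => by simp only [hmem l u hu]) (hSm l)
    simp [hS]
  have hio : IntegrableOn (fun u : ℝ => (c : ℂ) * h ⌊c * u⌋₊) (⋃ l, S l) := by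
    refine integrableOn_iUnion_of_summable_integral_norm hion ?_
    simp only [hnorm]
    exact hh.norm
  have h1 := hasSum_integral_iUnion hSm hSd hio
  simp only [hint, hSU] at h1
  rw [h1.tsum_eq, integral_Ici_eq_integral_Ioi]

theorem setIntegral_Ioi_add_right (f : ℝ → ℂ) (y : ℝ) :
    ∫ z in Set.Ioi (-y), f (z + y) = ∫ u in Set.Ioi 0, f u := by
  rw [← integral_indicator measurableSet_Ioi, ← integral_indicator measurableSet_Ioi,
    ← integral_add_right_eq_self ((Set.Ioi 0).indicator f) y]
  refine integral_congr_ae (Eventually.of_forall fun z => ?_)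
  simp only [Set.indicator, Set.mem_Ioi, neg_lt_iff_pos_add]

theorem setIntegral_Ioi_mul_add (f : ℝ → ℂ) {q : ℝ} (hq : 0 < q) (y : ℝ) :
    ∫ z in Set.Ioi (-y), f (q * (z + y)) = (q : ℂ)⁻¹ * ∫ u in Set.Ioi 0, f u := by
  rw [setIntegral_Ioi_add_right (fun u => f (q * u)) y, integral_comp_mul_left_Ioi _ _ hq, mul_zero,
    Complex.real_smul, Complex.ofReal_inv]

/-- In the variable `u = q(z + y)` the indices `l ≥ 0` fill the half line beyond `-y`, the origin of
the cutoff; the Jacobian is the `q` in the factor `q c`. -/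
theorem tsum_eq_integral_floor' {c q : ℝ} (hc : 0 < c) (hq : 0 < q) (y : ℝ) {h : ℕ → ℂ}
    (hh : Summable h) :
    ∑' l, h l = ∫ z in Set.Ioi (-y), ((q * c : ℝ) : ℂ) * h ⌊c * (q * (z + y))⌋₊ := by
  have hq0 : (q : ℂ) ≠ 0 := by exact_mod_cast hq.ne'
  rw [setIntegral_Ioi_mul_add (fun u => ((q * c : ℝ) : ℂ) * h ⌊c * u⌋₊) hq y,
    tsum_eq_integral_floor hc hh, ← integral_const_mul]
  refine integral_congr_ae (Eventually.of_forall fun u => ?_)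
  push_cast
  field_simp

theorem hasSum_exp_neg_div {s : ℝ} (hs : 1 ≤ s) :
    Summable (fun l : ℕ => Real.exp (-(l / s))) ∧ ∑' l : ℕ, Real.exp (-(l / s)) ≤ 2 * s := by
  have hs0 : 0 < s := by linarith
  have e : ∀ l : ℕ, Real.exp (-(l / s)) = Real.exp (-(1 / s)) ^ l := by
    intro l
    rw [← Real.exp_nat_mul]
    congr 1
    ring
  have h0 : Real.exp (-(1 / s)) < 1 := Real.exp_lt_one_iff.2 (neg_lt_zero.2 (by positivity))
  simp only [e]
  refine ⟨summable_geometric_of_lt_one (Real.exp_pos _).le h0, ?_⟩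
  rw [tsum_geometric_of_lt_one (Real.exp_pos _).le h0]
  have h1 : Real.exp (-(1 / s)) ≤ s / (s + 1) := by
    rw [Real.exp_neg, inv_le_comm₀ (Real.exp_pos _) (by positivity), inv_div]
    have := Real.add_one_le_exp (1 / s)
    have e2 : (s + 1) / s = 1 / s + 1 := by field_simp; ring
    rw [e2]
    exact this
  have h2 : s / (s + 1) ≤ 1 - (2 * s)⁻¹ := by
    rw [div_le_iff₀ (by positivity)]
    have : (1 - (2 * s)⁻¹) * (s + 1) = s + (1 - s⁻¹) / 2 := by field_simp; ring
    rw [this]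
    have : s⁻¹ ≤ 1 := inv_le_one_of_one_le₀ hs
    linarith
  rw [inv_le_comm₀ (by linarith) (by positivity)]
  linarith

/-! ### Powers of a rescaled matrix under a weighted bound -/

section Iterates

variable {A : ℝ → ℕ → ℕ → ℂ} {ω : ℝ → ℕ → ℝ} {C : ℝ}

theorem norm_mul_le_of_weighted {a b : ℂ} {Ca Cb s e e' x y z : ℝ} (hs : 0 < s) (he : 0 ≤ e)
    (hCa : 0 ≤ Ca) (hx : 0 < x) (hy : 0 < y)
    (ha : ‖a‖ ≤ Ca / s * e * (x / y)) (hb : ‖b‖ ≤ Cb / s * e' * (y / z)) :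
    ‖a * b‖ ≤ Ca * Cb / s ^ 2 * e' * (x / z) * e := by
  rw [norm_mul]
  refine (mul_le_mul ha hb (norm_nonneg _) (by positivity)).trans (le_of_eq ?_)
  field_simp

/-- The shape of the bound survives multiplication: the ratios of weights telescope, and the sum of
`e^(-l/√t)` is at most `2√t`, which cancels one of the two factors `1/√t`. -/
theorem exists_norm_matrixIter_le (hC : 0 < C) (hω : ∀ t j, 0 < ω t j)
    (hA : ∀ᶠ t in atTop, ∀ j k : ℕ,
      ‖A t j k‖ ≤ C / √t * Real.exp (-(k / √t)) * (ω t j / ω t k)) (m : ℕ) :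
    ∃ D > 0, ∀ᶠ t in atTop, ∀ j k : ℕ,
      ‖matrixIter (A t) m j k‖ ≤ D / √t * Real.exp (-(k / √t)) * (ω t j / ω t k) := by
  induction m with
  | zero => exact ⟨C, hC, hA⟩
  | succ m ih =>
    obtain ⟨D, hD, hm⟩ := ih
    refine ⟨2 * (C * D), by positivity, ?_⟩
    filter_upwards [hA, hm, eventually_ge_atTop 1] with t h1 h2 ht j k
    have hs : 1 ≤ √t := Real.one_le_sqrt.2 ht
    obtain ⟨h3, h4⟩ := hasSum_exp_neg_div hs
    have hj := hω t j
    have hk := hω t k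
    have h5 : ∀ l, ‖A t j l * matrixIter (A t) m l k‖ ≤
        C * D / √t ^ 2 * Real.exp (-(k / √t)) * (ω t j / ω t k) * Real.exp (-(l / √t)) :=
      fun l => norm_mul_le_of_weighted (by linarith) (Real.exp_pos _).le hC.le hj (hω t l)
        (h1 j l) (h2 l k)
    have h6 := tsum_of_norm_bounded (h3.hasSum.mul_left
      (C * D / √t ^ 2 * Real.exp (-(k / √t)) * (ω t j / ω t k))) h5
    simp only [matrixIter]
    refine h6.trans ((mul_le_mul_of_nonneg_left h4 (by positivity)).trans (le_of_eq ?_))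
    have : √t ≠ 0 := by linarith
    field_simp

theorem exp_neg_floor_div_le {s : ℝ} (hs : 1 ≤ s) (x : ℝ) :
    Real.exp (-((⌊s * x⌋₊ : ℝ) / s)) ≤ Real.exp 1 * Real.exp (-x) := by
  rw [← Real.exp_add]
  refine Real.exp_le_exp.2 ?_
  have h1 : s * x < ⌊s * x⌋₊ + 1 := Nat.lt_floor_add_one _
  have h2 : x - 1 ≤ (⌊s * x⌋₊ : ℝ) / s := by
    rw [le_div_iff₀ (by linarith)]
    nlinarith
  linarith

theorem integrableOn_exp_neg_mul_add {q : ℝ} (hq : 0 < q) (y : ℝ) :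
    IntegrableOn (fun w : ℝ => Real.exp (-(q * (w + y)))) (Set.Ioi (-y)) := by
  refine ((exp_neg_integrableOn_Ioi (-y) hq).const_mul (Real.exp (-(q * y)))).congr
    (Eventually.of_forall fun w => ?_)
  simp only
  rw [← Real.exp_add]
  congr 1
  ring

variable {q y : ℝ} {L : ℝ → ℝ → ℂ}

/-- Each matrix product is an integral of step functions over the half line. Domination by a
multiple of `e^(-q(w+y))` uses `ω_j ≤ 1` and a lower bound on the weight at the fixed right endpoint
only; the intermediate weight cancels. -/
theorem tendsto_matrixIter (hq : 0 < q) (hC : 0 < C) (hω : ∀ t j, 0 < ω t j)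
    (hω1 : ∀ t j, ω t j ≤ 1)
    (hωlow : ∀ s : ℝ, 0 ≤ s → ∃ c > 0, ∀ᶠ t in atTop, c ≤ ω t ⌊√t * s⌋₊)
    (hA : ∀ᶠ t in atTop, ∀ j k : ℕ,
      ‖A t j k‖ ≤ C / √t * Real.exp (-(k / √t)) * (ω t j / ω t k))
    (hL : ∀ z > -y, ∀ z' > -y, Tendsto (fun t : ℝ => ((q * √t : ℝ) : ℂ) *
      A t ⌊√t * (q * (z + y))⌋₊ ⌊√t * (q * (z' + y))⌋₊) atTop (𝓝 (L z z'))) (m : ℕ) :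
    ∀ z > -y, ∀ z' > -y, Tendsto (fun t : ℝ => ((q * √t : ℝ) : ℂ) *
      matrixIter (A t) m ⌊√t * (q * (z + y))⌋₊ ⌊√t * (q * (z' + y))⌋₊) atTop
      (𝓝 (kernelIter (volume.restrict (Set.Ioi (-y))) L m z z')) := by
  induction m with
  | zero => exact hL
  | succ m ih =>
    intro z hz z' hz'
    obtain ⟨D, hD, hm⟩ := exists_norm_matrixIter_le hC hω hA m
    obtain ⟨c, hc, hcω⟩ := hωlow (q * (z' + y)) (mul_nonneg hq.le (by linarith))
    have hlim : Tendsto (fun t : ℝ => ∫ w in Set.Ioi (-y),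
        (((q * √t : ℝ) : ℂ) * A t ⌊√t * (q * (z + y))⌋₊ ⌊√t * (q * (w + y))⌋₊) *
        (((q * √t : ℝ) : ℂ) *
          matrixIter (A t) m ⌊√t * (q * (w + y))⌋₊ ⌊√t * (q * (z' + y))⌋₊)) atTop
        (𝓝 (kernelIter (volume.restrict (Set.Ioi (-y))) L (m + 1) z z')) := by
      refine tendsto_integral_filter_of_dominated_convergence
        (fun w => q ^ 2 * (C * D) / c * (Real.exp 1 * Real.exp (-(q * (w + y))))) ?_ ?_
        (((integrableOn_exp_neg_mul_add hq y).const_mul _).const_mul _) ?_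
      · refine Eventually.of_forall fun t => Measurable.aestronglyMeasurable ?_
        have hf : Measurable fun w : ℝ => ⌊√t * (q * (w + y))⌋₊ :=
          Nat.measurable_floor.comp (by fun_prop)
        have h1 : Measurable fun l : ℕ => (((q * √t : ℝ) : ℂ) * A t ⌊√t * (q * (z + y))⌋₊ l) *
            (((q * √t : ℝ) : ℂ) * matrixIter (A t) m l ⌊√t * (q * (z' + y))⌋₊) :=
          measurable_from_nat
        exact h1.comp hf
      · filter_upwards [hA, hm, hcω, eventually_ge_atTop 1] with t h1 h2 h3 ht
        have hs : 1 ≤ √t := Real.one_le_sqrt.2 ht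
        have hs0 : √t ≠ 0 := by linarith
        filter_upwards [ae_restrict_mem measurableSet_Ioi] with w hw
        set j := ⌊√t * (q * (z + y))⌋₊
        set k := ⌊√t * (q * (z' + y))⌋₊
        set l := ⌊√t * (q * (w + y))⌋₊
        have h5 := norm_mul_le_of_weighted (by linarith) (Real.exp_pos _).le hC.le (hω t j)
          (hω t l) (h1 j l) (h2 l k)
        have hj := hω t j
        have hk := hω t k
        have h6 : ω t j / ω t k ≤ 1 / c :=
          div_le_div₀ zero_le_one (hω1 t j) hc h3
        have h7 : Real.exp (-((k : ℝ) / √t)) ≤ 1 :=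
          Real.exp_le_one_iff.2 (neg_nonpos.2 (by positivity))
        have h8 := exp_neg_floor_div_le hs (q * (w + y))
        calc ‖_‖ = q ^ 2 * √t ^ 2 * ‖A t j l * matrixIter (A t) m l k‖ := by
              rw [mul_mul_mul_comm, norm_mul, ← Complex.ofReal_mul, Complex.norm_real,
                Real.norm_eq_abs, abs_of_nonneg (by positivity)]
              ring
          _ ≤ q ^ 2 * √t ^ 2 * (C * D / √t ^ 2 * Real.exp (-(k / √t)) * (ω t j / ω t k) *
                Real.exp (-(l / √t))) := by gcongr
          _ ≤ q ^ 2 * √t ^ 2 * (C * D / √t ^ 2 * 1 * (1 / c) *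
                (Real.exp 1 * Real.exp (-(q * (w + y))))) := by gcongr
          _ = _ := by field_simp
      · filter_upwards [ae_restrict_mem measurableSet_Ioi] with w hw
        exact (hL z hz w hw).mul (ih w hw z' hz')
    refine hlim.congr' ?_
    filter_upwards [hA, hm, eventually_ge_atTop 1] with t h1 h2 ht
    have hs : 1 ≤ √t := Real.one_le_sqrt.2 ht
    set j := ⌊√t * (q * (z + y))⌋₊
    set k := ⌊√t * (q * (z' + y))⌋₊
    have hsum : Summable fun l => A t j l * matrixIter (A t) m l k :=
      Summable.of_norm_bounded ((hasSum_exp_neg_div hs).1.mul_left _) fun l =>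
        norm_mul_le_of_weighted (by linarith) (Real.exp_pos _).le hC.le (hω t j) (hω t l)
          (h1 j l) (h2 l k)
    simp only [matrixIter]
    rw [tsum_eq_integral_floor' (by linarith : 0 < √t) hq y hsum, ← integral_const_mul]
    refine integral_congr_ae (Eventually.of_forall fun w => ?_)
    simp only
    ring

theorem tendsto_tsum_matrixIter (hq : 0 < q) (hC : 0 < C) (hω : ∀ t j, 0 < ω t j)
    (hω1 : ∀ t j, ω t j ≤ 1)
    (hωlow : ∀ s : ℝ, 0 ≤ s → ∃ c > 0, ∀ᶠ t in atTop, c ≤ ω t ⌊√t * s⌋₊)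
    (hA : ∀ᶠ t in atTop, ∀ j k : ℕ,
      ‖A t j k‖ ≤ C / √t * Real.exp (-(k / √t)) * (ω t j / ω t k))
    (hL : ∀ z > -y, ∀ z' > -y, Tendsto (fun t : ℝ => ((q * √t : ℝ) : ℂ) *
      A t ⌊√t * (q * (z + y))⌋₊ ⌊√t * (q * (z' + y))⌋₊) atTop (𝓝 (L z z'))) (m : ℕ) :
    Tendsto (fun t : ℝ => ∑' k, matrixIter (A t) m k k) atTop
      (𝓝 (∫ z in Set.Ioi (-y), kernelIter (volume.restrict (Set.Ioi (-y))) L m z z)) := by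
  obtain ⟨D, hD, hm⟩ := exists_norm_matrixIter_le hC hω hA m
  have hlim : Tendsto (fun t : ℝ => ∫ z in Set.Ioi (-y), ((q * √t : ℝ) : ℂ) *
      matrixIter (A t) m ⌊√t * (q * (z + y))⌋₊ ⌊√t * (q * (z + y))⌋₊) atTop
      (𝓝 (∫ z in Set.Ioi (-y), kernelIter (volume.restrict (Set.Ioi (-y))) L m z z)) := by
    refine tendsto_integral_filter_of_dominated_convergence
      (fun w => q * D * (Real.exp 1 * Real.exp (-(q * (w + y))))) ?_ ?_
      (((integrableOn_exp_neg_mul_add hq y).const_mul _).const_mul _) ?_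
    · refine Eventually.of_forall fun t => Measurable.aestronglyMeasurable ?_
      have hf : Measurable fun w : ℝ => ⌊√t * (q * (w + y))⌋₊ :=
        Nat.measurable_floor.comp (by fun_prop)
      have h1 : Measurable fun l : ℕ => ((q * √t : ℝ) : ℂ) * matrixIter (A t) m l l :=
        measurable_from_nat
      exact h1.comp hf
    · filter_upwards [hm, eventually_ge_atTop 1] with t h2 ht
      have hs : 1 ≤ √t := Real.one_le_sqrt.2 ht
      have hs0 : √t ≠ 0 := by linarith
      filter_upwards [ae_restrict_mem measurableSet_Ioi] with w hw
      have h8 := exp_neg_floor_div_le hs (q * (w + y))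
      set l := ⌊√t * (q * (w + y))⌋₊
      have h5 := h2 l l
      -- On the diagonal the weights cancel, so the domination is uniform in `z`.
      rw [div_self (hω t l).ne', mul_one] at h5
      calc ‖_‖ = q * √t * ‖matrixIter (A t) m l l‖ := by
            rw [norm_mul, Complex.norm_real, Real.norm_eq_abs, abs_of_nonneg (by positivity)]
        _ ≤ q * √t * (D / √t * (Real.exp 1 * Real.exp (-(q * (w + y))))) := by
            gcongr
            exact h5.trans (by gcongr)
        _ = _ := by field_simp
    · filter_upwards [ae_restrict_mem measurableSet_Ioi] with w hw
      exact tendsto_matrixIter hq hC hω hω1 hωlow hA hL m w hw w hw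
  refine hlim.congr' ?_
  filter_upwards [hm, eventually_ge_atTop 1] with t h2 ht
  have hs : 1 ≤ √t := Real.one_le_sqrt.2 ht
  have hsum : Summable fun l => matrixIter (A t) m l l := by
    refine Summable.of_norm_bounded ((hasSum_exp_neg_div hs).1.mul_left (D / √t)) fun l => ?_
    have h5 := h2 l l
    rwa [div_self (hω t l).ne', mul_one] at h5
  rw [tsum_eq_integral_floor' (by linarith : 0 < √t) hq y hsum]

end Iterates

/-! ### Traces of powers of integral operators -/

section KernelTrace

variable {α : Type*} [MeasurableSpace α] {μ : Measure α}

theorem kernelIter_conj {k : α → α → ℂ} {u : α → ℂ} (hu : ∀ x, u x ≠ 0) (m : ℕ) (x y : α) :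
    kernelIter μ (fun x y => u x * k x y * (u y)⁻¹) m x y =
      u x * kernelIter μ k m x y * (u y)⁻¹ := by
  induction m generalizing x with
  | zero => rfl
  | succ m ih =>
    simp only [kernelIter, ih]
    rw [← integral_const_mul, ← integral_mul_const]
    refine integral_congr_ae (Eventually.of_forall fun w => ?_)
    have := hu w
    simp only
    field_simp

/-- The cutoffs at intermediate variables restrict the measure; only the one at the last variable
stays visible. -/
theorem kernelIter_indicator {s : Set α} (hs : MeasurableSet s) (k : α → α → ℂ) (m : ℕ) (x y : α) :
    kernelIter μ (fun x y => s.indicator (k x) y) m x y =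
      s.indicator (kernelIter (μ.restrict s) k m x) y := by
  induction m generalizing x with
  | zero => rfl
  | succ m ih =>
    simp only [kernelIter, ih]
    by_cases hy : y ∈ s
    · simp only [Set.indicator_of_mem hy]
      rw [← integral_indicator hs]
      refine integral_congr_ae (Eventually.of_forall fun w => ?_)
      simp only [Set.indicator]
      split_ifs <;> simp
    · simp [Set.indicator_of_notMem hy]

/-- The functions obtained from `b` by applying the integral operator with kernel `k`. -/
noncomputable def kernelApply (μ : Measure α) (k : α → α → ℂ) (b : α → ℂ) : ℕ → α → ℂ
  | 0 => b
  | m + 1 => fun x => ∫ y, k x y * kernelApply μ k b m y ∂μ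

theorem integralOperator_pow_ae [SFinite μ] {k : α → α → ℂ} (hk : MemLp (Function.uncurry k) 2 (μ.prod μ))
    {b : α → ℂ} (hb : MemLp b 2 μ) (m : ℕ) :
    (integralOperator μ k ^ m) (hb.toLp b) =ᵐ[μ] kernelApply μ k b m := by
  induction m with
  | zero => exact hb.coeFn_toLp
  | succ m ih =>
    rw [_root_.pow_succ', mul_apply_eq_comp]
    refine (integralOperator_ae hk _).trans (Eventually.of_forall fun x => ?_)
    refine integral_congr_ae ?_
    filter_upwards [ih] with y hy
    rw [hy]

theorem norm_kernelApply_le {k : α → α → ℂ} {b : α → ℂ} {g : α → ℝ} {S d : ℝ} (hS : 0 ≤ S)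
    (hg0 : ∀ x, 0 ≤ g x) (hg : MemLp g 2 μ) (hkg : ∀ x y, ‖k x y‖ ≤ S * g x * g y)
    (hbg : ∀ x, ‖b x‖ ≤ d * g x) (m : ℕ) (x : α) :
    ‖kernelApply μ k b m x‖ ≤ (S * ∫ w, g w ^ 2 ∂μ) ^ m * d * g x := by
  have hI : 0 ≤ ∫ w, g w ^ 2 ∂μ := integral_nonneg fun w => sq_nonneg _
  induction m generalizing x with
  | zero => simpa [kernelApply] using hbg x
  | succ m ih =>
    simp only [kernelApply]
    set D := S * ∫ w, g w ^ 2 ∂μ with hD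
    have hD0 : 0 ≤ D := mul_nonneg hS hI
    have h1 : ∀ w, ‖k x w * kernelApply μ k b m w‖ ≤ S * g x * (D ^ m * d) * g w ^ 2 := by
      intro w
      rw [norm_mul]
      have := hg0 x
      have := hg0 w
      calc _ ≤ (S * g x * g w) * (D ^ m * d * g w) :=
            mul_le_mul (hkg x w) (ih w) (norm_nonneg _) (by positivity)
        _ = _ := by ring
    refine (norm_integral_le_of_norm_le (hg.integrable_sq.const_mul _)
      (Eventually.of_forall h1)).trans (le_of_eq ?_)
    rw [integral_const_mul, _root_.pow_succ, hD]
    ring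

/-- Data of a kernel with an everywhere convergent separated expansion dominated by `g`. -/
structure IsSeparatedKernel (μ : Measure α) (k : α → α → ℂ) (a b : ℕ → α → ℂ) (g : α → ℝ)
    (c d : ℕ → ℝ) : Prop where
  memLp : MemLp (Function.uncurry k) 2 (μ.prod μ)
  aestronglyMeasurable : ∀ x, AEStronglyMeasurable (k x) μ
  c_nonneg : ∀ n, 0 ≤ c n
  d_nonneg : ∀ n, 0 ≤ d n
  summable : Summable fun n => c n * d n
  memLp_left : ∀ n, MemLp (a n) 2 μ
  memLp_right : ∀ n, MemLp (b n) 2 μ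
  memLp_bound : MemLp g 2 μ
  nonneg : ∀ x, 0 ≤ g x
  le_left : ∀ n x, ‖a n x‖ ≤ c n * g x
  le_right : ∀ n x, ‖b n x‖ ≤ d n * g x
  hasSum : ∀ x y, HasSum (fun n => b n x * starRingEnd ℂ (a n y)) (k x y)

/-! ### Traces of powers for a separated kernel -/

namespace IsSeparatedKernel

variable {k : α → α → ℂ} {a b : ℕ → α → ℂ} {g : α → ℝ} {c d : ℕ → ℝ}
  (h : IsSeparatedKernel μ k a b g c d)

include h

theorem norm_kernel_le (x y : α) : ‖k x y‖ ≤ (∑' n, c n * d n) * g x * g y := by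
  have h1 : ∀ n, ‖b n x * starRingEnd ℂ (a n y)‖ ≤ c n * d n * (g x * g y) := by
    intro n
    rw [norm_mul, RCLike.norm_conj]
    refine (mul_le_mul (h.le_right n x) (h.le_left n y) (norm_nonneg _)
      (mul_nonneg (h.d_nonneg n) (h.nonneg x))).trans (le_of_eq (by ring))
  have h2 := tsum_of_norm_bounded (h.summable.hasSum.mul_right (g x * g y)) h1
  rw [(h.hasSum x y).tsum_eq] at h2
  rw [mul_assoc]
  exact h2

theorem exists_norm_kernelApply_le (m : ℕ) : ∃ D ≥ 0, ∀ n x,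
    ‖kernelApply μ k (b n) m x‖ ≤ D * d n * g x := by
  have hS : 0 ≤ ∑' n, c n * d n := tsum_nonneg fun n => mul_nonneg (h.c_nonneg n) (h.d_nonneg n)
  exact ⟨_, pow_nonneg (mul_nonneg hS (integral_nonneg fun w => sq_nonneg _)) m, fun n x =>
    norm_kernelApply_le hS h.nonneg h.memLp_bound h.norm_kernel_le (h.le_right n) m x⟩

variable [SFinite μ]

theorem isNuclearRep : IsNuclearRep (fun n => (h.memLp_left n).toLp (a n))
    (fun n => (h.memLp_right n).toLp (b n)) (integralOperator μ k) :=
  isNuclearRep_integralOperator h.memLp h.c_nonneg h.d_nonneg h.summable h.memLp_left h.memLp_right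
    h.memLp_bound (fun n => Eventually.of_forall (h.le_left n))
    (fun n => Eventually.of_forall (h.le_right n))
    (Eventually.of_forall fun x => Eventually.of_forall (h.hasSum x))

theorem aestronglyMeasurable_kernelApply (m n : ℕ) :
    AEStronglyMeasurable (kernelApply μ k (b n) m) μ :=
  (Lp.aestronglyMeasurable _).congr (integralOperator_pow_ae h.memLp (h.memLp_right n) m)

/-- The expansion holds at every point, not just almost everywhere, so it may be evaluated on the
diagonal, which can be a null set. -/
theorem hasSum_kernelIter (m : ℕ) (x y : α) :
    HasSum (fun n => kernelApply μ k (b n) m x * starRingEnd ℂ (a n y))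
      (kernelIter μ k m x y) := by
  induction m generalizing x with
  | zero => exact h.hasSum x y
  | succ m ih =>
    obtain ⟨D, hD, hbd⟩ := h.exists_norm_kernelApply_le m
    set S := ∑' n, c n * d n with hS
    have hS0 : 0 ≤ S := tsum_nonneg fun n => mul_nonneg (h.c_nonneg n) (h.d_nonneg n)
    set F : ℕ → α → ℂ := fun n w => k x w * kernelApply μ k (b n) m w * starRingEnd ℂ (a n y)
      with hF
    have hFle : ∀ n w, ‖F n w‖ ≤ S * g x * D * g y * (c n * d n) * g w ^ 2 := by
      intro n w
      simp only [hF]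
      rw [norm_mul, norm_mul, RCLike.norm_conj]
      have := h.nonneg x
      have := h.nonneg w
      have := h.nonneg y
      have := h.c_nonneg n
      have := h.d_nonneg n
      calc _ ≤ (S * g x * g w) * (D * d n * g w) * (c n * g y) := by
            gcongr
            · exact h.norm_kernel_le x w
            · exact hbd n w
            · exact h.le_left n y
        _ = _ := by ring
    have hsq := h.memLp_bound.integrable_sq
    have hFi : ∀ n, Integrable (F n) μ := fun n =>
      (hsq.const_mul _).mono' (((h.aestronglyMeasurable x).mul
        (h.aestronglyMeasurable_kernelApply m n)).mul_const _) (Eventually.of_forall (hFle n))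
    have hFs : Summable fun n => ∫ w, ‖F n w‖ ∂μ := by
      refine Summable.of_nonneg_of_le (fun n => integral_nonneg fun _ => norm_nonneg _)
        (fun n => ?_) ((h.summable.mul_left (S * g x * D * g y)).mul_right (∫ w, g w ^ 2 ∂μ))
      rw [← integral_const_mul]
      exact integral_mono (hFi n).norm (hsq.const_mul _) (hFle n)
    have h1 := hasSum_integral_of_summable_integral_norm hFi hFs
    have h2 : ∀ n, ∫ w, F n w ∂μ =
        kernelApply μ k (b n) (m + 1) x * starRingEnd ℂ (a n y) := by
      intro n
      simp only [hF, kernelApply]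
      rw [integral_mul_const]
    have h3 : ∫ w, ∑' n, F n w ∂μ = kernelIter μ k (m + 1) x y := by
      simp only [kernelIter]
      refine integral_congr_ae (Eventually.of_forall fun w => ?_)
      simp only [hF, mul_assoc]
      rw [tsum_mul_left, (ih w).tsum_eq]
    rw [h3] at h1
    simpa only [h2] using h1

/-- The trace is `∑ ⟨a n, T^m b n⟩`; the bound `D c_n d_n g²` permits summing under the integral,
where the series is the diagonal of the iterated kernel. -/
theorem opTrace_pow (m : ℕ) :
    opTrace (integralOperator μ k ^ (m + 1)) = ∫ x, kernelIter μ k m x x ∂μ := by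
  obtain ⟨D, hD, hbd⟩ := h.exists_norm_kernelApply_le m
  rw [(h.isNuclearRep.pow_succ m).opTrace_eq]
  set F : ℕ → α → ℂ := fun n w => kernelApply μ k (b n) m w * starRingEnd ℂ (a n w) with hF
  have hFle : ∀ n w, ‖F n w‖ ≤ D * (c n * d n) * g w ^ 2 := by
    intro n w
    simp only [hF]
    rw [norm_mul, RCLike.norm_conj]
    have := h.nonneg w
    have := h.c_nonneg n
    have := h.d_nonneg n
    calc _ ≤ (D * d n * g w) * (c n * g w) := by
          gcongr
          · exact hbd n w
          · exact h.le_left n w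
      _ = _ := by ring
  have hsq := h.memLp_bound.integrable_sq
  have hFi : ∀ n, Integrable (F n) μ := fun n =>
    (hsq.const_mul _).mono' ((h.aestronglyMeasurable_kernelApply m n).mul
      (h.memLp_left n).star.1) (Eventually.of_forall (hFle n))
  have hFs : Summable fun n => ∫ w, ‖F n w‖ ∂μ := by
    refine Summable.of_nonneg_of_le (fun n => integral_nonneg fun _ => norm_nonneg _)
      (fun n => ?_) ((h.summable.mul_left D).mul_right (∫ w, g w ^ 2 ∂μ))
    rw [← integral_const_mul]
    exact integral_mono (hFi n).norm (hsq.const_mul _) (hFle n)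
  have h1 := hasSum_integral_of_summable_integral_norm hFi hFs
  have h2 : ∀ n, inner ℂ ((h.memLp_left n).toLp (a n))
      ((integralOperator μ k ^ m) ((h.memLp_right n).toLp (b n))) = ∫ w, F n w ∂μ := by
    intro n
    rw [inner_toLp_eq]
    refine integral_congr_ae ?_
    filter_upwards [integralOperator_pow_ae h.memLp (h.memLp_right n) m] with w hw
    rw [hw, mul_comm]
  simp only [h2]
  rw [h1.tsum_eq]
  refine integral_congr_ae (Eventually.of_forall fun w => ?_)
  exact (h.hasSum_kernelIter m w w).tsum_eq

end IsSeparatedKernel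

end KernelTrace

/-! ### The Mehler kernel -/

/-- The functions `√((pq)^n / n!) z^n e^(-(p² + q²) z² / 4)`. -/
noncomputable def mehlerFun (p q : ℝ) (n : ℕ) (z : ℝ) : ℝ :=
  √((p * q) ^ n / n.factorial) * (z ^ n * Real.exp (-(p ^ 2 + q ^ 2) / 4 * z ^ 2))

theorem continuous_mehlerFun (p q : ℝ) (n : ℕ) : Continuous (mehlerFun p q n) := by
  unfold mehlerFun
  fun_prop

/-- By `(βz²)^n/n! ≤ e^(βz²)`, giving up a factor `e^(βz²/2)` of Gaussian decay buys the geometric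
factor `(pq/β)^(n/2)`. -/
theorem abs_mehlerFun_le {p q : ℝ} (hp : 0 ≤ p) (hq : 0 < q) {β : ℝ} (hβ : 0 < β) (n : ℕ) (z : ℝ) :
    |mehlerFun p q n z| ≤ √((p * q / β) ^ n) *
      Real.exp (-((p ^ 2 + q ^ 2) / 4 - β / 2) * z ^ 2) := by
  refine Real.abs_le_sqrt ?_ |>.trans (le_of_eq ?_) (b := √((p * q / β) ^ n *
    Real.exp (-((p ^ 2 + q ^ 2) / 4 - β / 2) * z ^ 2) ^ 2))
  · have hpq : 0 ≤ p * q := by positivity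
    have h1 : (β * z ^ 2) ^ n / n.factorial ≤ Real.exp (β * z ^ 2) :=
      Real.pow_div_factorial_le_exp _ (by positivity) n
    rw [mehlerFun, mul_pow, Real.sq_sqrt (by positivity), mul_pow (z ^ n)]
    have e1 : Real.exp (-(p ^ 2 + q ^ 2) / 4 * z ^ 2) ^ 2 =
        Real.exp (-((p ^ 2 + q ^ 2) / 4 - β / 2) * z ^ 2) ^ 2 * (Real.exp (β * z ^ 2))⁻¹ := by
      rw [← Real.exp_nat_mul, ← Real.exp_nat_mul, ← Real.exp_neg, ← Real.exp_add]
      congr 1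
      push_cast
      ring
    rw [e1]
    have e2 : (p * q) ^ n / n.factorial * ((z ^ n) ^ 2 *
        (Real.exp (-((p ^ 2 + q ^ 2) / 4 - β / 2) * z ^ 2) ^ 2 * (Real.exp (β * z ^ 2))⁻¹)) =
        (p * q / β) ^ n * Real.exp (-((p ^ 2 + q ^ 2) / 4 - β / 2) * z ^ 2) ^ 2 *
          ((β * z ^ 2) ^ n / n.factorial / Real.exp (β * z ^ 2)) := by
      rw [div_pow, mul_pow β, ← pow_mul, ← pow_mul, mul_comm 2 n]
      field_simp
    rw [e2]
    refine mul_le_of_le_one_right (by positivity) ?_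
    rwa [div_le_one (Real.exp_pos _)]
  · have hpq : 0 ≤ p * q := by positivity
    rw [Real.sqrt_mul (by positivity), Real.sqrt_sq (Real.exp_pos _).le]

theorem mehlerFun_hasSum {p q : ℝ} (hp : 0 ≤ p) (hq : 0 < q) (z w : ℝ) :
    HasSum (fun n => (√(2 * π))⁻¹ * mehlerFun p q n z * mehlerFun p q n w)
      (mehlerKernel p q z w) := by
  have hpq : 0 ≤ p * q := by positivity
  have h1 : HasSum (fun n : ℕ => (p * q * z * w) ^ n / n.factorial)
      (Real.exp (p * q * z * w)) := by
    rw [Real.exp_eq_exp_ℝ]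
    exact NormedSpace.expSeries_div_hasSum_exp _
  have h2 := h1.mul_left ((√(2 * π))⁻¹ * Real.exp (-(p ^ 2 + q ^ 2) * (z ^ 2 + w ^ 2) / 4))
  convert h2 using 1
  · rfl
  · funext n
    have e1 : √((p * q) ^ n / n.factorial) * √((p * q) ^ n / n.factorial) =
        (p * q) ^ n / n.factorial := Real.mul_self_sqrt (by positivity)
    have e2 : Real.exp (-(p ^ 2 + q ^ 2) / 4 * z ^ 2) * Real.exp (-(p ^ 2 + q ^ 2) / 4 * w ^ 2) =
        Real.exp (-(p ^ 2 + q ^ 2) * (z ^ 2 + w ^ 2) / 4) := by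
      rw [← Real.exp_add]
      congr 1
      ring
    rw [← e2]
    unfold mehlerFun
    calc _ = (√(2 * π))⁻¹ * (√((p * q) ^ n / n.factorial) * √((p * q) ^ n / n.factorial)) *
          z ^ n * w ^ n * (Real.exp (-(p ^ 2 + q ^ 2) / 4 * z ^ 2) *
            Real.exp (-(p ^ 2 + q ^ 2) / 4 * w ^ 2)) := by ring
      _ = _ := by rw [e1]; ring
  · rw [mehlerKernel, Real.exp_add]
    ring

theorem isSeparatedKernel_mehler {p q : ℝ} (hp : 0 ≤ p) (hpq : p < q) (y : ℝ) :
    ∃ a b g c d, IsSeparatedKernel volume (fun z z' : ℝ =>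
      (Set.Ioi (-y)).indicator (fun w => (mehlerKernel p q z w : ℂ)) z') a b g c d := by
  have hq : 0 < q := by linarith
  have hpi := Real.pi_pos
  have hpq0 : 0 ≤ p * q := by positivity
  have hlt : p * q < (p ^ 2 + q ^ 2) / 2 := by nlinarith [sq_pos_of_pos (sub_pos.2 hpq)]
  -- The midpoint of `pq` and `(p²+q²)/2`, which are distinct because `p < q`: above `pq` for the
  -- geometric series, below `(p²+q²)/2` to keep some Gaussian decay.
  set β := (p * q + (p ^ 2 + q ^ 2) / 2) / 2 with hβ
  have hβ0 : 0 < β := by positivity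
  have hβ1 : p * q < β := by linarith
  have hβ2 : 0 < (p ^ 2 + q ^ 2) / 4 - β / 2 := by linarith
  set δ := (p ^ 2 + q ^ 2) / 4 - β / 2 with hδ
  set g : ℝ → ℝ := fun z => Real.exp (-δ * z ^ 2) with hg
  have hgL : MemLp g 2 volume := by
    rw [memLp_two_iff_integrable_sq (by fun_prop)]
    refine (integrable_exp_neg_mul_sq (b := 2 * δ) (by positivity)).congr
      (Eventually.of_forall fun z => ?_)
    simp only [hg]
    rw [← Real.exp_nat_mul]
    congr 1
    push_cast
    ring
  set a : ℕ → ℝ → ℂ := fun n => (Set.Ioi (-y)).indicator fun z => (mehlerFun p q n z : ℂ) with ha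
  set b : ℕ → ℝ → ℂ := fun n z => (((√(2 * π))⁻¹ * mehlerFun p q n z : ℝ) : ℂ) with hb
  have hcontC : ∀ n, Continuous fun z => (mehlerFun p q n z : ℂ) := fun n =>
    Complex.continuous_ofReal.comp (continuous_mehlerFun p q n)
  have hle0 : ∀ n z, ‖(mehlerFun p q n z : ℂ)‖ ≤ √((p * q / β) ^ n) * g z := by
    intro n z
    rw [Complex.norm_real, Real.norm_eq_abs]
    exact abs_mehlerFun_le hp hq hβ0 n z
  have hleA : ∀ n z, ‖a n z‖ ≤ √((p * q / β) ^ n) * g z := fun n z =>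
    (norm_indicator_le_norm_self _ _).trans (hle0 n z)
  have hleB : ∀ n z, ‖b n z‖ ≤ ((√(2 * π))⁻¹ * √((p * q / β) ^ n)) * g z := by
    intro n z
    simp only [hb]
    rw [Complex.ofReal_mul, norm_mul, Complex.norm_real, Real.norm_eq_abs,
      abs_of_nonneg (by positivity), mul_assoc]
    exact mul_le_mul_of_nonneg_left (hle0 n z) (by positivity)
  have hmA : ∀ n, AEStronglyMeasurable (a n) volume := fun n =>
    (hcontC n).aestronglyMeasurable.indicator measurableSet_Ioi
  have hmB : ∀ n, AEStronglyMeasurable (b n) volume := fun n =>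
    (Complex.continuous_ofReal.comp
      ((continuous_mehlerFun p q n).const_smul ((√(2 * π))⁻¹))).aestronglyMeasurable
  refine ⟨a, b, g, fun n => √((p * q / β) ^ n), fun n => (√(2 * π))⁻¹ * √((p * q / β) ^ n), ?_⟩
  refine ⟨mehlerCut_memLp hp hpq y, fun x => ?_, fun n => by positivity, fun n => by positivity, ?_,
    fun n => ?_, fun n => ?_, hgL, fun z => (Real.exp_pos _).le, hleA, hleB, fun z w => ?_⟩
  · refine AEStronglyMeasurable.indicator (Continuous.aestronglyMeasurable ?_) measurableSet_Ioi
    unfold mehlerKernel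
    fun_prop
  · refine ((summable_geometric_of_lt_one (by positivity)
      ((div_lt_one hβ0).2 hβ1)).mul_left (√(2 * π))⁻¹).congr fun n => ?_
    have : √((p * q / β) ^ n) * √((p * q / β) ^ n) = (p * q / β) ^ n :=
      Real.mul_self_sqrt (by positivity)
    calc (√(2 * π))⁻¹ * (p * q / β) ^ n
        = (√(2 * π))⁻¹ * (√((p * q / β) ^ n) * √((p * q / β) ^ n)) := by rw [this]
      _ = _ := by ring
  · exact MemLp.of_le_mul hgL (hmA n) (Eventually.of_forall fun z => by
      rw [Real.norm_of_nonneg (Real.exp_pos _).le]; exact hleA n z)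
  · exact MemLp.of_le_mul hgL (hmB n) (Eventually.of_forall fun z => by
      rw [Real.norm_of_nonneg (Real.exp_pos _).le]; exact hleB n z)
  · by_cases hw : w ∈ Set.Ioi (-y)
    · simp only [ha, hb, Set.indicator_of_mem hw, Complex.conj_ofReal]
      have := (mehlerFun_hasSum hp hq z w).mapL Complex.ofRealCLM
      simpa using this
    · simp only [ha, hb, Set.indicator_of_notMem hw, map_zero, mul_zero]
      exact hasSum_zero

theorem isTraceClass_mehlerCutOperator_pow {p q : ℝ} (hp : 0 ≤ p) (hpq : p < q) (y : ℝ) (m : ℕ) :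
    IsTraceClass (mehlerCutOperator p q y ^ (m + 1)) := by
  obtain ⟨a, b, g, c, d, h⟩ := isSeparatedKernel_mehler hp hpq y
  exact (h.isNuclearRep.pow_succ m).isTraceClass

theorem opTrace_mehlerCutOperator_pow {p q : ℝ} (hp : 0 ≤ p) (hpq : p < q) (y : ℝ) (m : ℕ) :
    opTrace (mehlerCutOperator p q y ^ (m + 1)) = ∫ z in Set.Ioi (-y),
      kernelIter (volume.restrict (Set.Ioi (-y))) (fun z w => (mehlerKernel p q z w : ℂ)) m z z := by
  obtain ⟨a, b, g, c, d, h⟩ := isSeparatedKernel_mehler hp hpq y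
  rw [mehlerCutOperator, h.opTrace_pow m, ← integral_indicator measurableSet_Ioi]
  refine integral_congr_ae (Eventually.of_forall fun z => ?_)
  simp only
  rw [kernelIter_indicator measurableSet_Ioi]
  rfl

/-- The limit kernel of the rescaled matrix is conjugate to the Mehler kernel. -/
theorem gaussian_eq_conj_mehlerKernel {p q : ℝ} (hq : q ≠ 0) (y z w : ℝ) :
    (((√(2 * π))⁻¹ * Real.exp (-(q * (z + y) - p / q * (q * (w + y)) - (q - p) * y) ^ 2 / 2) : ℝ)
      : ℂ) = (Real.exp (-((q ^ 2 - p ^ 2) / 4 * z ^ 2)) : ℂ) * (mehlerKernel p q z w : ℂ) *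
        (Real.exp (-((q ^ 2 - p ^ 2) / 4 * w ^ 2)) : ℂ)⁻¹ := by
  rw [← Complex.ofReal_inv, ← Real.exp_neg, ← Complex.ofReal_mul, ← Complex.ofReal_mul]
  congr 1
  rw [mehlerKernel]
  have e : Real.exp (-(q * (z + y) - p / q * (q * (w + y)) - (q - p) * y) ^ 2 / 2) =
      Real.exp (-((q ^ 2 - p ^ 2) / 4 * z ^ 2)) *
        Real.exp (-(p ^ 2 + q ^ 2) * (z ^ 2 + w ^ 2) / 4 + p * q * z * w) *
        Real.exp (- -((q ^ 2 - p ^ 2) / 4 * w ^ 2)) := by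
    rw [← Real.exp_add, ← Real.exp_add]
    congr 1
    field_simp
    ring
  rw [e]
  ring

theorem tendsto_opTrace_asepOperator_pow {p q : ℝ} (hp : 0 ≤ p) (hpq : p < q) (hsum : p + q = 1)
    (y : ℝ) {R : ℝ} (hR : 0 < R) (hpR : R + p < q * R ^ 2) (m : ℕ) :
    Tendsto (fun t : ℝ => opTrace (asepOperator p q (asepSite p q y t) t R ^ (m + 1)))
      atTop (𝓝 (opTrace (mehlerCutOperator p q y ^ (m + 1)))) := by
  have hq : 0 < q := by linarith
  have hR1 := one_lt_radius hp hpq hsum hR hpR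
  have hτ : 0 < 1 - p / q := sub_pos.2 ((div_lt_one hq).2 hpq)
  -- Any `B` above `1/(1 - p/q)` gives the strict gain.
  set B : ℝ := 2 / (1 - p / q) with hB
  have hB0 : 0 < B := by positivity
  have hBτ : 1 < B * (1 - p / q) := by
    rw [hB, div_mul_cancel₀ _ hτ.ne']
    norm_num
  have hB1 : 1 < B := by
    have : 0 ≤ p / q := by positivity
    nlinarith
  obtain ⟨C, hC, hA⟩ := exists_norm_asepEntry_le hp hpq hsum y hR hpR hB1 hBτ
  simp only [opTrace_asepOperator_pow hp hq hR hpR]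
  have hmain := tendsto_tsum_matrixIter (A := fun t => asepEntry p q (asepSite p q y t) t R)
    (ω := fun t j => asepWeight q B R t j) (q := q) (y := y) hq hC
    (fun t j => asepWeight_pos hB0 hR1.le j) (fun t j => asepWeight_le_one hB0 hR1.le j)
    (fun s hs => by
      obtain ⟨c, hc, h⟩ := exists_le_asepWeight hq hB0 hR1.le s
      refine ⟨c, hc, ?_⟩
      filter_upwards [eventually_gt_atTop 0] with t ht
      refine h t ht _ ?_
      rw [mul_comm s]
      exact Nat.floor_le (by positivity))
    hA
    (fun z hz z' hz' => tendsto_asepEntry hp hpq hsum y hR hpR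
      (mul_nonneg hq.le (by linarith)) (mul_nonneg hq.le (by linarith))) m
  convert hmain using 2
  rw [opTrace_mehlerCutOperator_pow hp hpq]
  refine integral_congr_ae (Eventually.of_forall fun z => ?_)
  simp only [gaussian_eq_conj_mehlerKernel hq.ne']
  have hu : ∀ z : ℝ, (Real.exp (-((q ^ 2 - p ^ 2) / 4 * z ^ 2)) : ℂ) ≠ 0 := fun z => by
    exact_mod_cast (Real.exp_pos _).ne'
  -- The conjugating factors telescope in the iterated kernel and cancel on the diagonal.
  rw [kernelIter_conj (k := fun z w => (mehlerKernel p q z w : ℂ))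
    (u := fun z : ℝ => (Real.exp (-((q ^ 2 - p ^ 2) / 4 * z ^ 2)) : ℂ)) hu]
  have := hu z
  field_simp

theorem mainTheorem2 (p q : ℝ) (hp : 0 ≤ p) (hpq : p < q) (hsum : p + q = 1) (y : ℝ)
    (R : ℝ) (hR : 0 < R) (hpR : R + p < q * R ^ 2) (n : ℕ) (hn : 1 ≤ n) :
    (∀ x t : ℝ, IsTraceClass (asepOperator p q x t R ^ n)) ∧
    IsTraceClass (mehlerCutOperator p q y ^ n) ∧
    Tendsto (fun t : ℝ => opTrace (asepOperator p q ((p - q) * t + (q - p) * y * √t) t R ^ n))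
      atTop (𝓝 (opTrace (mehlerCutOperator p q y ^ n))) := by
  obtain ⟨m, rfl⟩ := Nat.exists_eq_add_of_le' hn
  exact ⟨fun x t => isTraceClass_asepOperator_pow hp (by linarith) hR hpR x t m,
    isTraceClass_mehlerCutOperator_pow hp hpq y m,
    tendsto_opTrace_asepOperator_pow hp hpq hsum y hR hpR m⟩
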